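/- For $0<r<R$ write $A(r,R)=\{z\in\mathbb C: r<|z|<R\}$. Let $1<R<\infty$, $\mathbb A=A(1,R)$, $\mathbb A^*=A(1,R_*)$, where $R_*=\frac12\left(R+\frac1R\right)$. Let $\mathcal H(\mathbb A,\mathbb A^*)$ be the class of all complex-valued harmonic functions $h$ on $\mathbb A$ that are orientation preserving homeomorphisms of $\mathbb A$ onto $\mathbb A^*$ and whose cluster set at the inner circle $\{|z|=1\}$ of $\mathbb A$ (the set of all limits of sequences $h(z_j)$ with $z_j\in\mathbb A$, $|z_j|\to1$) is the inner circle $\{|w|=1\}$ of $\mathbb A^*$. For a function $f$ on the circle $C_\rho=\{|z|=\rho\}$ let $\frac1{2\pi}\int_0^{2\pi} f(\rho e^{i\theta})\,d\theta$ be its average over $C_\rho$. Let $\mathcal H_D(\mathbb A,\mathbb A^*)$ be the subclass of those $h\in\mathcal H(\mathbb A,\mathbb A^*)$ for which $$\lim_{\rho\searrow1}\frac1{2\pi}\int_0^{2\pi}h(\rho e^{i\theta})\,d\theta=0,$$ and let $\mathcal H_N(\mathbb A,\mathbb A^*)$ be the subclass of those $h\in\mathcal H(\mathbb A,\mathbb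 A^*)$ for which the average over $C_\rho$ of the normal derivative $\frac{\partial h}{\partial n}$, that is, of the radial derivative $\frac{\partial h}{\partial\rho}$, is zero for some $\rho\in(1,R)$. Let $h^1(z)=\frac12\left(z+\frac1{\bar z}\right)$. Then $$\mathcal H_D(\mathbb A,\mathbb A^*)=\mathcal H_N(\mathbb A,\mathbb A^*)=\{\alpha h^1:\alpha\in\mathbb C,\ |\alpha|=1\}.$$ If in addition $\log R\le\frac32$, then $\mathcal H(\mathbb A,\mathbb A^*)=\{\alpha h^1:\alpha\in\mathbb C,\ |\alpha|=1\}$. -/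

import Mathlib

open Filter Topology

noncomputable section

namespace NitscheAnnuli

/-- The open round annulus `A(r, R) = {z : r < |z| < R}`. -/
def annulus (r R : ℝ) : Set ℂ := {z | r < ‖z‖ ∧ ‖z‖ < R}

/-- `h` restricts to a homeomorphism of `U` onto `V`. -/
def IsHomeoOn (h : ℂ → ℂ) (U V : Set ℂ) : Prop :=
  ∃ e : U ≃ₜ V, ∀ z : U, (e z : ℂ) = h z

/-- The loop `γ`, parametrized by `[0, 2π]`, avoids `0` and has winding number `n` about `0`:
it has a continuous logarithm which increases by `2πin` along the loop. -/
def HasWindingNumber (γ : ℝ → ℂ) (n : ℤ) : Prop :=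
  ∃ φ : ℝ → ℂ, ContinuousOn φ (Set.Icc 0 (2 * Real.pi)) ∧
    (∀ θ ∈ Set.Icc (0 : ℝ) (2 * Real.pi), Complex.exp (φ θ) = γ θ) ∧
    φ (2 * Real.pi) - φ 0 = 2 * Real.pi * Complex.I * n

/-- A homeomorphism `h` of the open set `U` onto its image preserves orientation: its local degree
at each point is `+1`, that is, for every closed disc in `U`, the image of the positively oriented
boundary circle winds once, in the positive direction, around the image of the centre. -/
def PreservesOrientationOn (h : ℂ → ℂ) (U : Set ℂ) : Prop :=
  ∀ a : ℂ, ∀ ε : ℝ, 0 < ε → Metric.closedBall a ε ⊆ U →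
    HasWindingNumber (fun θ => h (circleMap a ε θ) - h a) 1

/-- The cluster set of `h : U → ℂ` at the set `E ⊆ ∂U`: the limit points of `h z` as `z ∈ U`
approaches `E`. -/
def clusterSet (h : ℂ → ℂ) (U E : Set ℂ) : Set ℂ :=
  {w | MapClusterPt w (𝓝ˢ E ⊓ 𝓟 U) h}

/-- The class `𝓗(A(r, R), A(r', R'))` of orientation preserving harmonic homeomorphisms of
`A(r, R)` onto `A(r', R')` whose cluster set at the inner circle of `A(r, R)` is the inner circle
of `A(r', R')`. Only the values of `h` on `A(r, R)` matter. -/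
def harmonicHomeos (r R r' R' : ℝ) : Set (ℂ → ℂ) :=
  {h | InnerProductSpace.HarmonicOnNhd h (annulus r R) ∧
    IsHomeoOn h (annulus r R) (annulus r' R') ∧
    PreservesOrientationOn h (annulus r R) ∧
    clusterSet h (annulus r R) (Metric.sphere 0 r) = Metric.sphere 0 r'}

/-- The subclass `𝓗_D` of mappings with vanishing average on the inner circle. -/
def harmonicHomeosD (r R r' R' : ℝ) : Set (ℂ → ℂ) :=
  {h | h ∈ harmonicHomeos r R r' R' ∧
    Tendsto (fun ρ : ℝ => Real.circleAverage h 0 ρ) (𝓝[>] r) (𝓝 0)}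

/-- The derivative of `h` at `z ≠ 0` in the direction of the outer normal `z / |z|` of the circle
through `z` centred at `0`. -/
def normalDeriv (h : ℂ → ℂ) (z : ℂ) : ℂ := fderiv ℝ h z (z / ‖z‖)

/-- The subclass `𝓗_N` of mappings whose normal derivative has vanishing average on some circle
`|z| = ρ` with `r < ρ < R`. -/
def harmonicHomeosN (r R r' R' : ℝ) : Set (ℂ → ℂ) :=
  {h | h ∈ harmonicHomeos r R r' R' ∧
    ∃ ρ : ℝ, r < ρ ∧ ρ < R ∧ Real.circleAverage (normalDeriv h) 0 ρ = 0}

/-- The critical Nitsche map `h¹(z) = (z + 1 / z̄) / 2`. -/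
def nitscheMap (z : ℂ) : ℂ := (1 / 2) * (z + 1 / (starRingEnd ℂ) z)

/-- The functions which agree on `A(1, R)` with a rotation `α h¹`, `|α| = 1`, of the critical
Nitsche map. -/
def nitscheRotations (R : ℝ) : Set (ℂ → ℂ) :=
  {h | ∃ α : ℂ, ‖α‖ = 1 ∧ Set.EqOn h (fun z => α * nitscheMap z) (annulus 1 R)}

end NitscheAnnuli

end

/-! ### Circular means, Fourier coefficients and Parseval's identity. -/

noncomputable section
namespace NitscheAnnuli

open MeasureTheory Set ComplexConjugate

/-! Put `T = log R`, so that `R_* = cosh T`, and pass to `F (t, θ) = h (exp (t + iθ))`, which is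
harmonic for `0 < t < T`, periodic in `θ`, with `1 < |F| < cosh T`. The goal is `F = α cosh t
e^{iθ}`. Let `c_n(t)` be the Fourier coefficients of `F (t, ·)`, `U = Σ |c_n|²` the quadratic mean
and `A = Σ n |c_n|²` the enclosed area divided by `π`. Since `c_n'' = n² c_n`, the data `c_n, c_n'`
at time `t` determine `c_n(T)`, and `Σ |c_n(T)|² ≤ cosh² T`.

Three facts come from the inner boundary: `U → 1`; `U' ≥ 0`, because `U` is convex and at least `1`;
and `limsup A ≥ 1`, because the winding number is one. The last fact (`frequently_area_ge`) assumes
no boundary regularity and is proved on well chosen circles.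

With `τ = T - t` and a weight `κ ≥ 0`, summing `modeExcess` over all modes gives at most `cosh² T -
sinh τ cosh τ U' - cosh² τ U - κ (A - U)`, whose lower limit as `t → 0` is at most `0`. If every
mode has nonnegative excess for small `t`, all excesses are therefore zero at `t = 0`. Modes other
than `0, 1` have positive definite excess (`Admissible`) and vanish. For `n = 1` the excess is
`sinh² τ |c_1'|²`, so `c_1'(0) = 0`. Then `A` forces `|c_1(0)| ≥ 1`, `U → 1` forces `c_0(0) = 0`,
and the excess of the zeroth mode kills `c_0'`. This is `exists_eq_cosh_mul_exp`.

The extra hypotheses serve only the zeroth mode. A large `κ` helps the modes `n ≤ 0` and hurts `n ≥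
2`. The weight `2 sinh² τ` is admissible for all `τ > 0`; it settles the Neumann case (`c_0' = 0`),
the Dirichlet case (`c_0(0) = 0`), and every `c_0` when `τ ≤ 1`. The weight `2 sinh τ cosh τ` is
admissible for `τ ≥ 1` and covers `1 ≤ τ ≤ 3/2`.

That `h` winds once along concentric circles is deduced from local orientation in
`exists_log_comp_exp`. The converse inclusions are direct computations with `h¹`. -/

/-- The mean of a function over `[0, 2π]`. -/
def mean {E : Type*} [NormedAddCommGroup E] [NormedSpace ℝ E] (f : ℝ → E) : E :=
  (2 * Real.pi)⁻¹ • ∫ θ in (0 : ℝ)..2 * Real.pi, f θ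

/-- The `n`-th Fourier coefficient of a function on `[0, 2π]`. -/
def coeff (f : ℝ → ℂ) (n : ℤ) : ℂ :=
  mean fun θ => Complex.exp (-(n * θ * Complex.I)) * f θ

section mean

variable {E : Type*} [NormedAddCommGroup E] [NormedSpace ℝ E]

lemma mean_add {f g : ℝ → E} (hf : Continuous f) (hg : Continuous g) :
    mean (fun θ => f θ + g θ) = mean f + mean g := by
  unfold mean
  rw [intervalIntegral.integral_add (hf.intervalIntegrable _ _) (hg.intervalIntegrable _ _),
    smul_add]

lemma mean_sub {f g : ℝ → E} (hf : Continuous f) (hg : Continuous g) :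
    mean (fun θ => f θ - g θ) = mean f - mean g := by
  unfold mean
  rw [intervalIntegral.integral_sub (hf.intervalIntegrable _ _) (hg.intervalIntegrable _ _),
    smul_sub]

lemma mean_const_mul (c : ℝ) (f : ℝ → ℝ) : mean (fun θ => c * f θ) = c * mean f := by
  unfold mean
  rw [intervalIntegral.integral_const_mul, smul_eq_mul, smul_eq_mul]
  ring

lemma mean_const (c : ℝ) : mean (fun _ => c) = c := by
  unfold mean
  have := Real.pi_pos
  simp
  field_simp

lemma mean_mono {f g : ℝ → ℝ} (hf : Continuous f) (hg : Continuous g) (h : ∀ θ, f θ ≤ g θ) :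
    mean f ≤ mean g := by
  unfold mean
  have := Real.pi_pos
  gcongr
  exact intervalIntegral.integral_mono (by positivity) (hf.intervalIntegrable _ _)
    (hg.intervalIntegrable _ _) h

lemma mean_deriv_eq_zero [CompleteSpace E] {f f' : ℝ → E} (hf : ∀ θ, HasDerivAt f (f' θ) θ)
    (hf' : Continuous f') (h : f (2 * Real.pi) = f 0) : mean f' = 0 := by
  unfold mean
  rw [intervalIntegral.integral_eq_sub_of_hasDerivAt (fun θ _ => hf θ)
    (hf'.intervalIntegrable _ _), h, sub_self, smul_zero]

lemma eq_zero_of_mean_eq_zero {f : ℝ → ℝ} (hf : Continuous f) (h0 : ∀ θ, 0 ≤ f θ)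
    (h : mean f = 0) : ∀ θ ∈ Icc 0 (2 * Real.pi), f θ = 0 := by
  have hpi := Real.pi_pos
  by_contra! hne
  obtain ⟨θ, hθ, hne⟩ := hne
  have : 0 < ∫ θ in (0 : ℝ)..2 * Real.pi, f θ :=
    intervalIntegral.integral_pos (by positivity) hf.continuousOn (fun x _ => h0 x)
      ⟨θ, hθ, lt_of_le_of_ne (h0 θ) hne.symm⟩
  unfold mean at h
  rw [smul_eq_mul] at h
  have : 0 < (2 * Real.pi)⁻¹ * ∫ θ in (0 : ℝ)..2 * Real.pi, f θ := by positivity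
  linarith

lemma hasDerivAt_mean [CompleteSpace E] {a b : ℝ} {f f' : ℝ → ℝ → E}
    (hf : ContinuousOn (Function.uncurry f) (Ioo a b ×ˢ univ))
    (hf' : ContinuousOn (Function.uncurry f') (Ioo a b ×ˢ univ))
    (hd : ∀ t ∈ Ioo a b, ∀ θ, HasDerivAt (fun s => f s θ) (f' t θ) t) {t : ℝ} (ht : t ∈ Ioo a b) :
    HasDerivAt (fun s => mean (f s)) (mean (f' t)) t := by
  have slice : ∀ {g : ℝ → ℝ → E}, ContinuousOn (Function.uncurry g) (Ioo a b ×ˢ univ) →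
      ∀ s ∈ Ioo a b, Continuous (g s) := fun {g} hg s hs =>
    hg.comp_continuous (f := fun θ : ℝ => (s, θ)) (by fun_prop) fun θ => ⟨hs, mem_univ _⟩
  obtain ⟨ε, hε, hball⟩ : ∃ ε > 0, Metric.closedBall t ε ⊆ Ioo a b :=
    Metric.nhds_basis_closedBall.mem_iff.1 (Ioo_mem_nhds ht.1 ht.2)
  obtain ⟨C, hC⟩ := ((isCompact_closedBall t ε).prod
    (isCompact_uIcc (a := (0 : ℝ)) (b := 2 * Real.pi))).exists_bound_of_continuousOn
    (hf'.mono (prod_mono hball (subset_univ _)))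
  have key := intervalIntegral.hasDerivAt_integral_of_dominated_loc_of_deriv_le
    (μ := volume) (a := 0) (b := 2 * Real.pi) (F := f) (F' := f') (x₀ := t)
    (s := Metric.closedBall t ε) (bound := fun _ => C) (Metric.closedBall_mem_nhds t hε)
    ?_ ((slice hf t ht).intervalIntegrable _ _) (slice hf' t ht).aestronglyMeasurable ?_
    intervalIntegrable_const ?_
  · exact key.2.const_smul _
  · filter_upwards [Ioo_mem_nhds ht.1 ht.2] with s hs using (slice hf s hs).aestronglyMeasurable
  · exact .of_forall fun θ hθ s hs => hC (s, θ) ⟨hs, uIoc_subset_uIcc hθ⟩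
  · exact .of_forall fun θ _ s hs => hd s (hball hs) θ

end mean

section coeff

/-- Gives access to Mathlib's Parseval identity for `fourierCoeffOn`. -/
lemma coeff_eq_fourierCoeffOn (f : ℝ → ℂ) (n : ℤ) :
    coeff f n = fourierCoeffOn Real.two_pi_pos f n := by
  rw [fourierCoeffOn_eq_integral]
  unfold coeff mean
  rw [one_div, sub_zero]
  congr 1
  refine intervalIntegral.integral_congr fun θ _ => ?_
  simp only [fourier_coe_apply, smul_eq_mul]
  congr 2
  have : (Real.pi : ℂ) ≠ 0 := by exact_mod_cast Real.pi_ne_zero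
  push_cast
  field_simp

lemma coeff_add {f g : ℝ → ℂ} (hf : Continuous f) (hg : Continuous g) (n : ℤ) :
    coeff (fun θ => f θ + g θ) n = coeff f n + coeff g n := by
  unfold coeff
  rw [← mean_add (by fun_prop) (by fun_prop)]
  simp only [mul_add]

lemma coeff_sub {f g : ℝ → ℂ} (hf : Continuous f) (hg : Continuous g) (n : ℤ) :
    coeff (fun θ => f θ - g θ) n = coeff f n - coeff g n := by
  unfold coeff
  rw [← mean_sub (by fun_prop) (by fun_prop)]
  simp only [mul_sub]

lemma coeff_const_mul (c : ℂ) (f : ℝ → ℂ) (n : ℤ) :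
    coeff (fun θ => c * f θ) n = c * coeff f n := by
  rw [coeff_eq_fourierCoeffOn, coeff_eq_fourierCoeffOn, fourierCoeffOn.const_mul]

lemma hasSum_sq_coeff {f : ℝ → ℂ} (hf : Continuous f) :
    HasSum (fun n => ‖coeff f n‖ ^ 2) (mean fun θ => ‖f θ‖ ^ 2) := by
  have h2 : MemLp f 2 (volume.restrict (Ioc 0 (2 * Real.pi))) := by
    refine (memLp_two_iff_integrable_sq_norm hf.aestronglyMeasurable).2 ?_
    have : IntervalIntegrable (fun θ => ‖f θ‖ ^ 2) volume 0 (2 * Real.pi) :=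
      Continuous.intervalIntegrable (by fun_prop) _ _
    exact (intervalIntegrable_iff_integrableOn_Ioc_of_le Real.two_pi_pos.le).1 this
  have := hasSum_sq_fourierCoeffOn Real.two_pi_pos h2
  simp only [← coeff_eq_fourierCoeffOn, sub_zero] at this
  exact this

/-- Parseval's identity for the real inner product. -/
lemma hasSum_re_coeff_mul_conj {f g : ℝ → ℂ} (hf : Continuous f) (hg : Continuous g) :
    HasSum (fun n => (coeff f n * conj (coeff g n)).re)
      (mean fun θ => (f θ * conj (g θ)).re) := by
  -- Polarization reduces the claim to the norm identity for `f + g` and `f - g`.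
  have polar : ∀ z w : ℂ, (z * conj w).re = 1 / 4 * (‖z + w‖ ^ 2 - ‖z - w‖ ^ 2) := by
    intro z w
    rw [← Complex.normSq_eq_norm_sq, ← Complex.normSq_eq_norm_sq, Complex.normSq_add,
      Complex.normSq_sub]
    ring
  simp only [polar, ← coeff_add hf hg, ← coeff_sub hf hg]
  rw [mean_const_mul, mean_sub (by fun_prop) (by fun_prop)]
  exact ((hasSum_sq_coeff (hf.add hg)).sub (hasSum_sq_coeff (hf.sub hg))).mul_left (1 / 4)

lemma coeff_deriv {f f' : ℝ → ℂ} (hf : ∀ θ, HasDerivAt f (f' θ) θ) (hf' : Continuous f')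
    (h : f (2 * Real.pi) = f 0) (n : ℤ) : coeff f' n = n * Complex.I * coeff f n := by
  have hfc : Continuous f := continuous_iff_continuousAt.2 fun θ => (hf θ).continuousAt
  have hexp : ∀ θ : ℝ, HasDerivAt (fun θ : ℝ => Complex.exp (-(n * θ * Complex.I)))
      (Complex.exp (-(n * θ * Complex.I)) * -(n * Complex.I)) θ := by
    intro θ
    have := (((Complex.ofRealCLM.hasDerivAt (x := θ)).const_mul (n : ℂ)).mul_const
      Complex.I).neg.cexp
    simpa using this
  have key := mean_deriv_eq_zero (fun θ => (hexp θ).mul (hf θ)) (by fun_prop) (by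
    have : Complex.exp (-(n * (2 * Real.pi : ℝ) * Complex.I)) = 1 := by
      rw [Complex.exp_eq_one_iff]
      exact ⟨-n, by push_cast; ring⟩
    simp only [this, h, Pi.mul_apply]
    simp)
  rw [mean_add (by fun_prop) (by fun_prop)] at key
  have e : mean (fun θ : ℝ => Complex.exp (-(n * θ * Complex.I)) * -(n * Complex.I) * f θ)
      = -(n * Complex.I) * coeff f n := by
    rw [← coeff_const_mul]
    unfold coeff
    congr 1
    ext θ
    ring
  rw [e] at key
  change _ + coeff f' n = 0 at key
  linear_combination key

/-- The function satisfies `f' = i f`, so `coeff_deriv` gives `(n - 1) i c_n = 0`. -/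
lemma coeff_exp_of_ne {n : ℤ} (hn : n ≠ 1) : 
    coeff (fun θ : ℝ => Complex.exp (θ * Complex.I)) n = 0 := by
  have := coeff_deriv (f := fun θ : ℝ => Complex.exp (θ * Complex.I))
    (f' := fun θ : ℝ => Complex.I * Complex.exp (θ * Complex.I)) (fun θ => by
      simpa [mul_comm] using ((Complex.ofRealCLM.hasDerivAt (x := θ)).mul_const Complex.I).cexp)
    (by fun_prop) (by simp) n
  rw [coeff_const_mul] at this
  have h1 : ((n : ℂ) - 1) ≠ 0 := by
    rw [sub_ne_zero]; exact_mod_cast hn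
  have h2 : ((n : ℂ) - 1) * Complex.I * coeff (fun θ : ℝ => Complex.exp (θ * Complex.I)) n = 0 := by
    linear_combination -this
  simpa [h1] using h2

lemma coeff_exp_one : coeff (fun θ : ℝ => Complex.exp (θ * Complex.I)) 1 = 1 := by
  unfold coeff mean
  have hpi := Real.pi_pos
  have : ∀ θ : ℝ, Complex.exp (-((1 : ℤ) * θ * Complex.I)) * Complex.exp (θ * Complex.I) = 1 := by
    intro θ
    rw [← Complex.exp_add]
    simp
  simp only [this]
  simp
  have : (Real.pi : ℂ) ≠ 0 := by exact_mod_cast Real.pi_ne_zero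
  field_simp

lemma eq_of_coeff_eq {f g : ℝ → ℂ} (hf : Continuous f) (hg : Continuous g)
    (h : ∀ n, coeff f n = coeff g n) : ∀ θ ∈ Icc 0 (2 * Real.pi), f θ = g θ := by
  have h0 : mean (fun θ => ‖f θ - g θ‖ ^ 2) = 0 := by
    refine (hasSum_sq_coeff (hf.sub hg)).unique ?_
    convert hasSum_zero with n
    rw [show coeff (f - g) n = _ from coeff_sub hf hg n, h n]
    simp
  intro θ hθ
  have := eq_zero_of_mean_eq_zero (by fun_prop) (fun θ => by positivity) h0 θ hθ
  exact sub_eq_zero.1 (by simpa using this)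

end coeff

end NitscheAnnuli
end

/-! ### Quadratic means and enclosed area of a harmonic function on a strip. -/

noncomputable section
namespace NitscheAnnuli

open MeasureTheory Set ComplexConjugate

/-- `F (t, θ)` is harmonic for `0 < t < T` and `2π`-periodic in `θ`, with partial derivatives
`P = F_t`, `Q = F_θ` and `L = F_tt = -F_θθ`. -/
structure StripHarmonic (T : ℝ) (F P Q L : ℝ → ℝ → ℂ) : Prop where
  contF : ContinuousOn (Function.uncurry F) (Ioo 0 T ×ˢ univ)
  contP : ContinuousOn (Function.uncurry P) (Ioo 0 T ×ˢ univ)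
  contQ : ContinuousOn (Function.uncurry Q) (Ioo 0 T ×ˢ univ)
  contL : ContinuousOn (Function.uncurry L) (Ioo 0 T ×ˢ univ)
  derivF : ∀ t ∈ Ioo 0 T, ∀ θ, HasDerivAt (fun s => F s θ) (P t θ) t
  derivP : ∀ t ∈ Ioo 0 T, ∀ θ, HasDerivAt (fun s => P s θ) (L t θ) t
  derivF' : ∀ t ∈ Ioo 0 T, ∀ θ, HasDerivAt (F t) (Q t θ) θ
  derivQ : ∀ t ∈ Ioo 0 T, ∀ θ, HasDerivAt (Q t) (-L t θ) θ
  perF : ∀ t ∈ Ioo 0 T, F t (2 * Real.pi) = F t 0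
  perQ : ∀ t ∈ Ioo 0 T, Q t (2 * Real.pi) = Q t 0

lemma continuous_slice {E : Type*} [TopologicalSpace E] {g : ℝ → ℝ → E} {I : Set ℝ}
    (hg : ContinuousOn (Function.uncurry g) (I ×ˢ univ)) {t : ℝ} (ht : t ∈ I) :
    Continuous (g t) :=
  hg.comp_continuous (f := fun θ : ℝ => (t, θ)) (by fun_prop) fun _ => ⟨ht, mem_univ _⟩

/-- The quadratic mean of `F` over the circle with parameter `t`. -/
def sqMean (F : ℝ → ℝ → ℂ) (t : ℝ) : ℝ := mean fun θ => ‖F t θ‖ ^ 2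

/-- The mean of `Re (f conj g)` over the circle with parameter `t`. -/
def innerMean (f g : ℝ → ℝ → ℂ) (t : ℝ) : ℝ := mean fun θ => (f t θ * conj (g t θ)).re

namespace StripHarmonic

variable {T : ℝ} {F P Q L : ℝ → ℝ → ℂ}

lemma hasDerivAt_sqMean (h : StripHarmonic T F P Q L) {t : ℝ} (ht : t ∈ Ioo 0 T) :
    HasDerivAt (sqMean F) (2 * innerMean P F t) t := by
  have hF := h.contF
  have hP := h.contP
  unfold sqMean innerMean
  rw [← mean_const_mul]
  refine hasDerivAt_mean (f := fun t θ => ‖F t θ‖ ^ 2)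
    (f' := fun t θ => 2 * (P t θ * conj (F t θ)).re) (a := 0) (b := T) ?_ ?_ ?_ ht
  · exact hF.norm.pow 2
  · have := (Complex.continuous_re.comp_continuousOn
      (hP.mul (Complex.continuous_conj.comp_continuousOn hF))).const_mul 2
    exact this
  · intro s hs θ
    have := (h.derivF s hs θ).norm_sq
    rw [Complex.inner] at this
    exact this

/-- The derivative is the mean of `|P|² + Re (L conj F)`. Since `L = -F_θθ`, integration by parts in
`θ` turns the second term into `|Q|²`. Hence `U = sqMean F` is convex, with `U' = 2 innerMean P F`.
-/
lemma hasDerivAt_innerMean (h : StripHarmonic T F P Q L) {t : ℝ} (ht : t ∈ Ioo 0 T) :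
    HasDerivAt (innerMean P F) (sqMean P t + sqMean Q t) t := by
  have cF := continuous_slice h.contF ht
  have cP := continuous_slice h.contP ht
  have cQ := continuous_slice h.contQ ht
  have cL := continuous_slice h.contL ht
  have hderiv : ∀ {f g : ℝ → ℂ} {f' g' : ℂ} {x : ℝ}, HasDerivAt f f' x → HasDerivAt g g' x →
      HasDerivAt (fun x => (f x * conj (g x)).re) ((f' * conj (g x)).re + (f x * conj g').re) x := by
    intro f g f' g' x hf hg
    have hg' : HasDerivAt (fun x => conj (g x)) (conj g') x := hg.star
    have := Complex.reCLM.hasFDerivAt.comp_hasDerivAt x (hf.mul hg')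
    rw [map_add] at this
    exact this
  have e : innerMean L F t = sqMean Q t := by
    have := mean_deriv_eq_zero (fun θ => hderiv (h.derivQ t ht θ) (h.derivF' t ht θ))
      (by fun_prop) (by simp only [h.perF t ht, h.perQ t ht])
    rw [mean_add (by fun_prop) (by fun_prop)] at this
    unfold innerMean sqMean
    have e1 : (mean fun θ => (-L t θ * conj (F t θ)).re)
        = (-1) * mean fun θ => (L t θ * conj (F t θ)).re := by
      rw [← mean_const_mul]
      congr 1; ext θ; simp
    have e2 : (mean fun θ => ‖Q t θ‖ ^ 2) = mean fun θ => (Q t θ * conj (Q t θ)).re := by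
      congr 1; ext θ
      rw [Complex.mul_conj, Complex.ofReal_re, Complex.normSq_eq_norm_sq]
    rw [e2]
    linarith
  rw [← e, add_comm]
  unfold innerMean sqMean
  have e3 : (mean fun θ => ‖P t θ‖ ^ 2) = mean fun θ => (P t θ * conj (P t θ)).re := by
    congr 1; ext θ
    rw [Complex.mul_conj, Complex.ofReal_re, Complex.normSq_eq_norm_sq]
  rw [e3, ← mean_add (by fun_prop) (by fun_prop)]
  refine hasDerivAt_mean (f := fun t θ => (P t θ * conj (F t θ)).re)
    (f' := fun t θ => (L t θ * conj (F t θ)).re + (P t θ * conj (P t θ)).re)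
    (a := 0) (b := T) ?_ ?_ ?_ ht
  · exact Complex.continuous_re.comp_continuousOn
      (h.contP.mul (Complex.continuous_conj.comp_continuousOn h.contF))
  · exact (Complex.continuous_re.comp_continuousOn
      (h.contL.mul (Complex.continuous_conj.comp_continuousOn h.contF))).add
      (Complex.continuous_re.comp_continuousOn
      (h.contP.mul (Complex.continuous_conj.comp_continuousOn h.contP)))
  · intro s hs θ
    exact hderiv (h.derivP s hs θ) (h.derivF s hs θ)

lemma sqMean_nonneg (h : StripHarmonic T F P Q L) {t : ℝ} (ht : t ∈ Ioo 0 T) :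
    0 ≤ sqMean P t ∧ 0 ≤ sqMean Q t := by
  have cP := continuous_slice h.contP ht
  have cQ := continuous_slice h.contQ ht
  have h0 : mean (fun _ : ℝ => (0 : ℝ)) = 0 := mean_const 0
  exact ⟨h0 ▸ mean_mono continuous_const (by fun_prop) fun θ => by positivity,
    h0 ▸ mean_mono continuous_const (by fun_prop) fun θ => by positivity⟩

lemma monotoneOn_innerMean (h : StripHarmonic T F P Q L) :
    MonotoneOn (innerMean P F) (Ioo 0 T) := by
  refine monotoneOn_of_deriv_nonneg (convex_Ioo 0 T)
    (fun t ht => (h.hasDerivAt_innerMean ht).continuousAt.continuousWithinAt)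
    (fun t ht => ?_) (fun t ht => ?_) <;> rw [interior_Ioo] at ht
  · exact (h.hasDerivAt_innerMean ht).differentiableAt.differentiableWithinAt
  · rw [(h.hasDerivAt_innerMean ht).deriv]
    exact add_nonneg (h.sqMean_nonneg ht).1 (h.sqMean_nonneg ht).2

lemma tendsto_sqMean (h : StripHarmonic T F P Q L) (hT : 0 < T)
    (h1 : ∀ t ∈ Ioo 0 T, ∀ θ, 1 < ‖F t θ‖)
    (hlim : ∀ δ > 0, ∀ᶠ t in 𝓝[>] (0 : ℝ), ∀ θ, ‖F t θ‖ ^ 2 ≤ 1 + δ) :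
    Tendsto (sqMean F) (𝓝[>] 0) (𝓝 1) := by
  have hI : ∀ᶠ t in 𝓝[>] (0 : ℝ), t ∈ Ioo 0 T := Ioo_mem_nhdsGT hT
  rw [tendsto_order]
  constructor
  · intro a ha
    filter_upwards [hI] with t ht
    have cF := continuous_slice h.contF ht
    refine ha.trans_le ?_
    rw [← mean_const 1]
    exact mean_mono continuous_const (by fun_prop) fun θ => one_le_pow₀ (h1 t ht θ).le
  · intro a ha
    filter_upwards [hI, hlim ((a - 1) / 2) (by linarith)] with t ht hb
    have cF := continuous_slice h.contF ht
    have : sqMean F t ≤ 1 + (a - 1) / 2 := by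
      rw [← mean_const (1 + (a - 1) / 2)]
      exact mean_mono (by fun_prop) continuous_const hb
    linarith

/-- Convexity of `U`: the mean value theorem on `[r, s]`, with `U'` nondecreasing, followed by `r →
0`. Together with `U ≥ 1` it yields `U' ≥ 0`. -/
lemma sqMean_sub_one_le (h : StripHarmonic T F P Q L)
    (hU : Tendsto (sqMean F) (𝓝[>] 0) (𝓝 1)) {s : ℝ} (hs : s ∈ Ioo 0 T) :
    sqMean F s - 1 ≤ 2 * innerMean P F s * s := by
  have hlim : Tendsto (fun r => sqMean F s - sqMean F r) (𝓝[>] 0) (𝓝 (sqMean F s - 1)) :=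
    hU.const_sub _
  have hlim2 : Tendsto (fun r => 2 * innerMean P F s * (s - r)) (𝓝[>] 0)
      (𝓝 (2 * innerMean P F s * (s - 0))) :=
    ((continuous_const.mul (continuous_const.sub continuous_id)).tendsto' _ _ rfl).mono_left
      nhdsWithin_le_nhds
  rw [sub_zero] at hlim2
  refine le_of_tendsto_of_tendsto hlim hlim2 ?_
  filter_upwards [Ioo_mem_nhdsGT hs.1] with r hr
  have hsub : Icc r s ⊆ Ioo 0 T := fun x hx => ⟨hr.1.trans_le hx.1, hx.2.trans_lt hs.2⟩
  obtain ⟨ξ, hξ, e⟩ := exists_hasDerivAt_eq_slope (sqMean F) (fun x => 2 * innerMean P F x) hr.2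
    (fun x hx => (h.hasDerivAt_sqMean (hsub hx)).continuousAt.continuousWithinAt)
    (fun x hx => h.hasDerivAt_sqMean (hsub (Ioo_subset_Icc_self hx)))
  rw [eq_div_iff (sub_pos.2 hr.2).ne'] at e
  rw [← e]
  have := h.monotoneOn_innerMean (hsub (Ioo_subset_Icc_self hξ)) hs hξ.2.le
  have := sub_pos.2 hr.2
  gcongr

/-- The area enclosed by the images of small circles, divided by `π`, has upper limit at least
one. -/
lemma frequently_area_ge (h : StripHarmonic T F P Q L) (hT : 0 < T)
    (h1 : ∀ t ∈ Ioo 0 T, ∀ θ, 1 < ‖F t θ‖)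
    (hlim : ∀ δ > 0, ∀ᶠ t in 𝓝[>] (0 : ℝ), ∀ θ, ‖F t θ‖ ^ 2 ≤ 1 + δ)
    (hw : ∀ t ∈ Ioo 0 T, mean (fun θ => (Q t θ / F t θ).im) = 1) {δ : ℝ} (hδ : 0 < δ) :
    ∃ᶠ t in 𝓝[>] (0 : ℝ), 1 - δ ≤ innerMean Q (fun t θ => Complex.I * F t θ) t := by
  have hU := h.tendsto_sqMean hT h1 hlim
  have hU1 : ∀ t ∈ Ioo 0 T, 1 ≤ sqMean F t := by
    intro t ht
    have cF := continuous_slice h.contF ht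
    rw [← mean_const 1]
    exact mean_mono continuous_const (by fun_prop) fun θ => one_le_pow₀ (h1 t ht θ).le
  have hU' : ∀ t ∈ Ioo 0 T, 0 ≤ innerMean P F t := by
    intro t ht
    have := h.sqMean_sub_one_le hU ht
    have := hU1 t ht
    by_contra! hneg
    nlinarith [ht.1]
  -- `B = U'(T/2)` bounds `U'` on `(0, T/2]`. The total error below is at most `e B`, and `e` is
  -- chosen to make this at most `δ`.
  set B := 2 * innerMean P F (T / 2) with hB
  have hT2 : T / 2 ∈ Ioo 0 T := ⟨by linarith, by linarith⟩
  have hB0 : 0 ≤ B := by have := hU' _ hT2; positivity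
  set e := min 1 (δ / (B + 1)) with he
  have he0 : 0 < e := by positivity
  have heB : e * B ≤ δ := by
    have : e ≤ δ / (B + 1) := min_le_right _ _
    rw [le_div_iff₀ (by linarith)] at this
    nlinarith
  rw [frequently_iff]
  intro S hS
  obtain ⟨η, hη, hηS⟩ := mem_nhdsGT_iff_exists_Ioo_subset.1
    (inter_mem hS (hlim (e ^ 2) (by positivity)))
  rw [mem_Ioi] at hη
  set ε := min (η / 2) (T / 2) with hε
  have hε0 : 0 < ε := by positivity
  have hεη : ε < η := (min_le_left _ _).trans_lt (by linarith)
  have hεT : ε ≤ T / 2 := min_le_right _ _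
  have hsub : Icc (ε / 2) ε ⊆ Ioo 0 T := fun x hx =>
    ⟨by linarith [hx.1], by linarith [hx.2]⟩
  -- The mean value theorem selects a circle on which the mean of `|Q|²` is at most `B / ε`. Other
  -- circles need not satisfy this bound, which is why the conclusion holds only frequently.
  obtain ⟨s, hs, es⟩ := exists_hasDerivAt_eq_slope (innerMean P F)
    (fun x => sqMean P x + sqMean Q x) (show ε / 2 < ε by linarith)
    (fun x hx => (h.hasDerivAt_innerMean (hsub hx)).continuousAt.continuousWithinAt)
    (fun x hx => h.hasDerivAt_innerMean (hsub (Ioo_subset_Icc_self hx)))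
  have hsT := hsub (Ioo_subset_Icc_self hs)
  have hsη : s ∈ Ioo 0 η := ⟨hsT.1, hs.2.trans hεη⟩
  refine ⟨s, (hηS hsη).1, ?_⟩
  have hbd : ∀ θ, ‖F s θ‖ ^ 2 ≤ 1 + e ^ 2 := (hηS hsη).2
  have hQ : sqMean Q s * ε ≤ B := by
    have h1 := hU' (ε / 2) (hsub ⟨le_rfl, by linarith⟩)
    have h2 := h.monotoneOn_innerMean (hsub ⟨by linarith, le_rfl⟩) hT2 hεT
    have h3 := (h.sqMean_nonneg hsT).1
    rw [eq_div_iff (by linarith)] at es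
    nlinarith
  have hUs : sqMean F s - 1 ≤ B * ε := by
    have h1 := h.sqMean_sub_one_le hU hsT
    have h2 := h.monotoneOn_innerMean hsT hT2 (hs.2.le.trans hεT)
    have h3 := hU' s hsT
    have h4 := hs.2.le
    have : 2 * innerMean P F s * s ≤ B * ε :=
      mul_le_mul (by linarith) h4 hsT.1.le hB0
    linarith
  have cF := continuous_slice h.contF hsT
  have cQ := continuous_slice h.contQ hsT
  have hne : ∀ θ, F s θ ≠ 0 := fun θ h0 => by
    have := h1 s hsT θ
    rw [h0, norm_zero] at this
    linarith
  have cQF : Continuous fun θ => (Q s θ / F s θ).im :=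
    Complex.continuous_im.comp (cQ.div cF hne)
  -- The area integrand is `|F|² Im (Q / F)` and `Im (Q / F)` has mean one, so the loss is at most
  -- `(|F|² - 1) |Q|`. It is split by a weighted arithmetic-geometric inequality, and `|F|² - 1 ≤
  -- e²` lowers the square of `|F|² - 1` to its first power. The two means are then controlled by `U
  -- - 1 ≤ B ε` and by `B / ε`.
  have pt : ∀ θ, (Q s θ / F s θ).im ≤ (Q s θ * conj (Complex.I * F s θ)).re
      + (e / (2 * ε) * (‖F s θ‖ ^ 2 - 1) + e * ε / 2 * ‖Q s θ‖ ^ 2) := by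
    intro θ
    have n1 := h1 s hsT θ
    have e1 : (Q s θ * conj (Complex.I * F s θ)).re = ‖F s θ‖ ^ 2 * (Q s θ / F s θ).im := by
      have e2 : Q s θ = Q s θ / F s θ * F s θ := (div_mul_cancel₀ _ (hne θ)).symm
      generalize Q s θ / F s θ = w at e2
      rw [e2, ← Complex.normSq_eq_norm_sq, Complex.normSq_apply]
      simp
      ring
    rw [e1]
    have q1 : |(Q s θ / F s θ).im| ≤ ‖Q s θ‖ := by
      refine (Complex.abs_im_le_norm _).trans ?_
      rw [norm_div]
      exact div_le_self (norm_nonneg _) n1.le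
    have hv := hbd θ
    have u0 : 0 ≤ ‖F s θ‖ ^ 2 - 1 := by nlinarith
    have hu : (‖F s θ‖ ^ 2 - 1) ^ 2 ≤ e ^ 2 * (‖F s θ‖ ^ 2 - 1) := by nlinarith
    have hy := (abs_le.1 q1).1
    have amgm : (‖F s θ‖ ^ 2 - 1) * ‖Q s θ‖ ≤
        (‖F s θ‖ ^ 2 - 1) ^ 2 / (2 * e * ε) + e * ε / 2 * ‖Q s θ‖ ^ 2 := by
      have h0 : 0 ≤ (‖F s θ‖ ^ 2 - 1 - e * ε * ‖Q s θ‖) ^ 2 / (2 * e * ε) := by positivity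
      have e0 : (‖F s θ‖ ^ 2 - 1 - e * ε * ‖Q s θ‖) ^ 2 / (2 * e * ε)
          = (‖F s θ‖ ^ 2 - 1) ^ 2 / (2 * e * ε) + e * ε / 2 * ‖Q s θ‖ ^ 2
            - (‖F s θ‖ ^ 2 - 1) * ‖Q s θ‖ := by
        field_simp
        ring
      linarith
    have h3 : (‖F s θ‖ ^ 2 - 1) ^ 2 / (2 * e * ε) ≤ e / (2 * ε) * (‖F s θ‖ ^ 2 - 1) := by
      calc (‖F s θ‖ ^ 2 - 1) ^ 2 / (2 * e * ε)
          ≤ e ^ 2 * (‖F s θ‖ ^ 2 - 1) / (2 * e * ε) := by gcongr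
        _ = e / (2 * ε) * (‖F s θ‖ ^ 2 - 1) := by field_simp
    nlinarith
  have hm := mean_mono cQF (by fun_prop) pt
  rw [hw s hsT, mean_add (by fun_prop) (by fun_prop), mean_add (by fun_prop) (by fun_prop),
    mean_const_mul, mean_const_mul, mean_sub (by fun_prop) (by fun_prop), mean_const] at hm
  change 1 ≤ innerMean Q (fun t θ => Complex.I * F t θ) s
    + (e / (2 * ε) * (sqMean F s - 1) + e * ε / 2 * sqMean Q s) at hm
  have k1 : e / (2 * ε) * (sqMean F s - 1) ≤ e * B / 2 := by
    calc e / (2 * ε) * (sqMean F s - 1) ≤ e / (2 * ε) * (B * ε) := by gcongr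
      _ = e * B / 2 := by field_simp
  have k2 : e * ε / 2 * sqMean Q s ≤ e * B / 2 := by nlinarith
  linarith

end StripHarmonic

end NitscheAnnuli
end

/-! ### Evolution of a single Fourier mode and its excess. -/

noncomputable section
namespace NitscheAnnuli

open MeasureTheory Set ComplexConjugate

open Real (sinh cosh sinh_sq cosh_sq)

/-- The solution of `y'' = n² y`, `y 0 = 0`, `y' 0 = 1`. -/
def sinhDiv (n : ℤ) (t : ℝ) : ℝ := if n = 0 then t else sinh (n * t) / n

lemma hasDerivAt_sinhDiv (n : ℤ) (t : ℝ) : HasDerivAt (sinhDiv n) (cosh (n * t)) t := by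
  unfold sinhDiv
  split_ifs with hn
  · simpa [hn] using hasDerivAt_id' t
  · have hn' : (n : ℝ) ≠ 0 := by exact_mod_cast hn
    have := ((hasDerivAt_id t).const_mul (n : ℝ)).sinh.div_const (n : ℝ)
    simpa [hn'] using this

lemma hasDerivAt_cosh_mul (n : ℤ) (t : ℝ) :
    HasDerivAt (fun t : ℝ => cosh (n * t)) (n ^ 2 * sinhDiv n t) t := by
  have := ((hasDerivAt_id t).const_mul (n : ℝ)).cosh
  refine this.congr_deriv ?_
  unfold sinhDiv
  split_ifs with hn
  · simp [hn]
  · have hn' : (n : ℝ) ≠ 0 := by exact_mod_cast hn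
    simp
    field_simp

lemma cosh_sq_sub_sinhDiv_sq (n : ℤ) (t : ℝ) :
    cosh (n * t) ^ 2 - n ^ 2 * sinhDiv n t ^ 2 = 1 := by
  unfold sinhDiv
  split_ifs with hn
  · simp [hn]
  · have hn' : (n : ℝ) ≠ 0 := by exact_mod_cast hn
    rw [cosh_sq]
    field_simp
    ring

lemma sinhDiv_add (n : ℤ) (s t : ℝ) :
    sinhDiv n (s + t) = sinhDiv n s * cosh (n * t) + cosh (n * s) * sinhDiv n t := by
  unfold sinhDiv
  split_ifs with hn
  · simp [hn]
  · have hn' : (n : ℝ) ≠ 0 := by exact_mod_cast hn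
    rw [mul_add, Real.sinh_add]
    field_simp

lemma cosh_mul_add (n : ℤ) (s t : ℝ) :
    cosh (n * (s + t)) = cosh (n * s) * cosh (n * t) + n ^ 2 * sinhDiv n s * sinhDiv n t := by
  unfold sinhDiv
  split_ifs with hn
  · simp [hn]
  · have hn' : (n : ℝ) ≠ 0 := by exact_mod_cast hn
    rw [mul_add, Real.cosh_add]
    field_simp

/-- Solving the two formulas for `p` and `q` (the determinant is one by `cosh_sq_sub_sinhDiv_sq`)
gives expressions in `c, d` with zero derivative; their values at `T / 2` are taken. Thus `p, q` act
as initial data at `0`, although `c` is controlled only on the open interval. -/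
lemma exists_eq_cosh_add_sinhDiv {T : ℝ} (hT : 0 < T) (n : ℤ) {c d : ℝ → ℂ}
    (hc : ∀ t ∈ Ioo 0 T, HasDerivAt c (d t) t)
    (hd : ∀ t ∈ Ioo 0 T, HasDerivAt d (n ^ 2 * c t) t) :
    ∃ p q : ℂ, ∀ t ∈ Ioo 0 T, c t = p * cosh (n * t) + q * sinhDiv n t ∧
      d t = p * (n ^ 2 * sinhDiv n t) + q * cosh (n * t) := by
  have h1 : ∀ t, HasDerivAt (fun t : ℝ => (cosh (n * t) : ℂ)) ((n ^ 2 * sinhDiv n t : ℝ) : ℂ) t :=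
    fun t => (hasDerivAt_cosh_mul n t).ofReal_comp
  have h2 : ∀ t, HasDerivAt (fun t : ℝ => (sinhDiv n t : ℂ)) (cosh (n * t) : ℂ) t :=
    fun t => (hasDerivAt_sinhDiv n t).ofReal_comp
  have hmid : T / 2 ∈ Ioo 0 T := ⟨by linarith, by linarith⟩
  have const : ∀ g : ℝ → ℂ, (∀ t ∈ Ioo 0 T, HasDerivAt g 0 t) →
      ∀ t ∈ Ioo 0 T, g t = g (T / 2) := fun g hg t ht =>
    (convex_Ioo 0 T).is_const_of_fderivWithin_eq_zero (𝕜 := ℝ)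
      (fun x hx => (hg x hx).differentiableAt.differentiableWithinAt)
      (fun x hx => by
        rw [fderivWithin_eq_fderiv (isOpen_Ioo.uniqueDiffWithinAt hx) (hg x hx).differentiableAt]
        have := (hg x hx).hasFDerivAt.fderiv
        rw [this]; ext; simp) ht hmid
  have hp := const (fun t => c t * cosh (n * t) - d t * sinhDiv n t) fun t ht => by
    refine (((hc t ht).mul (h1 t)).sub ((hd t ht).mul (h2 t))).congr_deriv ?_
    push_cast; ring
  have hq := const (fun t => d t * cosh (n * t) - c t * (n ^ 2 * sinhDiv n t)) fun t ht => by
    refine (((hd t ht).mul (h1 t)).sub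
      ((hc t ht).mul ((h2 t).const_mul ((n : ℂ) ^ 2)))).congr_deriv ?_
    push_cast; ring
  refine ⟨c (T / 2) * cosh (n * (T / 2)) - d (T / 2) * sinhDiv n (T / 2),
    d (T / 2) * cosh (n * (T / 2)) - c (T / 2) * (n ^ 2 * sinhDiv n (T / 2)),
    fun t ht => ⟨?_, ?_⟩⟩
  · rw [← hp t ht, ← hq t ht]
    have : ((cosh (n * t) ^ 2 - n ^ 2 * sinhDiv n t ^ 2 : ℝ) : ℂ) = 1 := by
      rw [cosh_sq_sub_sinhDiv_sq]; norm_num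
    push_cast at this
    push_cast
    linear_combination (-c t) * this
  · rw [← hp t ht, ← hq t ht]
    have : ((cosh (n * t) ^ 2 - n ^ 2 * sinhDiv n t ^ 2 : ℝ) : ℂ) = 1 := by
      rw [cosh_sq_sub_sinhDiv_sq]; norm_num
    push_cast at this
    push_cast
    linear_combination (-d t) * this

/-- The excess of the `n`-th mode with initial data `c`, `c'` after time `τ`. -/
def modeExcess (κ τ : ℝ) (n : ℤ) (c c' : ℂ) : ℝ :=
  ‖c * cosh (n * τ) + c' * sinhDiv n τ‖ ^ 2 - 2 * (sinh τ * cosh τ) * (c' * conj c).re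
    - (cosh τ ^ 2 + κ * (n - 1)) * ‖c‖ ^ 2

/-- Displays the excess as a quadratic form in `c'` and `c`. For `n = 1` the weight drops out and
only `sinh² τ |c'|²` remains. -/
lemma modeExcess_eq (κ τ : ℝ) (n : ℤ) (c c' : ℂ) :
    modeExcess κ τ n c c' = sinhDiv n τ ^ 2 * ‖c'‖ ^ 2
      + 2 * (sinhDiv n τ * cosh (n * τ) - sinh τ * cosh τ) * (c' * conj c).re
      + (cosh (n * τ) ^ 2 - (cosh τ ^ 2 + κ * (n - 1))) * ‖c‖ ^ 2 := by
  unfold modeExcess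
  rw [← Complex.normSq_eq_norm_sq, Complex.normSq_add, Complex.normSq_mul, Complex.normSq_mul,
    Complex.normSq_ofReal, Complex.normSq_ofReal, ← Complex.normSq_eq_norm_sq,
    ← Complex.normSq_eq_norm_sq]
  simp only [Complex.mul_re, Complex.mul_im, Complex.conj_re, Complex.conj_im, Complex.ofReal_re,
    Complex.ofReal_im, map_mul]
  ring

/-- Completing the square, so that the sign of the excess is decided by a discriminant. -/
lemma mul_quadratic_eq (a b d : ℝ) (x y : ℂ) :
    a * (a * ‖y‖ ^ 2 + 2 * b * (y * conj x).re + d * ‖x‖ ^ 2)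
      = ‖a * y + b * x‖ ^ 2 + (a * d - b ^ 2) * ‖x‖ ^ 2 := by
  rw [← Complex.normSq_eq_norm_sq, ← Complex.normSq_eq_norm_sq, ← Complex.normSq_eq_norm_sq,
    Complex.normSq_add, Complex.normSq_mul, Complex.normSq_mul,
    Complex.normSq_ofReal, Complex.normSq_ofReal]
  simp only [Complex.mul_re, Complex.mul_im, Complex.conj_re, Complex.conj_im, Complex.ofReal_re,
    Complex.ofReal_im, map_mul]
  ring

lemma sinhDiv_ne_zero {τ : ℝ} (hτ : τ ≠ 0) (n : ℤ) : sinhDiv n τ ≠ 0 := by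
  unfold sinhDiv
  split_ifs with hn
  · exact hτ
  · have hn' : (n : ℝ) ≠ 0 := by exact_mod_cast hn
    exact div_ne_zero (by rw [Ne, Real.sinh_eq_zero]; exact mul_ne_zero hn' hτ) hn'

lemma modeExcess_nonneg {κ τ : ℝ} (hτ : τ ≠ 0) {n : ℤ}
    (h : (sinhDiv n τ * cosh (n * τ) - sinh τ * cosh τ) ^ 2
      ≤ sinhDiv n τ ^ 2 * (cosh (n * τ) ^ 2 - (cosh τ ^ 2 + κ * (n - 1)))) (c c' : ℂ) :
    0 ≤ modeExcess κ τ n c c' := by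
  have h1 := mul_quadratic_eq (sinhDiv n τ ^ 2) (sinhDiv n τ * cosh (n * τ) - sinh τ * cosh τ)
    (cosh (n * τ) ^ 2 - (cosh τ ^ 2 + κ * (n - 1))) c c'
  rw [← modeExcess_eq] at h1
  have h2 := sinhDiv_ne_zero hτ n
  have h3 : 0 < sinhDiv n τ ^ 2 := by positivity
  have h4 := mul_nonneg (sub_nonneg.2 h) (sq_nonneg ‖c‖)
  refine nonneg_of_mul_nonneg_right (a := sinhDiv n τ ^ 2) ?_ h3
  rw [h1]
  positivity

lemma eq_zero_of_modeExcess_nonpos {κ τ : ℝ} (hτ : τ ≠ 0) {n : ℤ}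
    (h : (sinhDiv n τ * cosh (n * τ) - sinh τ * cosh τ) ^ 2
      < sinhDiv n τ ^ 2 * (cosh (n * τ) ^ 2 - (cosh τ ^ 2 + κ * (n - 1)))) {c c' : ℂ}
    (h0 : modeExcess κ τ n c c' ≤ 0) : c = 0 ∧ c' = 0 := by
  have h1 := mul_quadratic_eq (sinhDiv n τ ^ 2) (sinhDiv n τ * cosh (n * τ) - sinh τ * cosh τ)
    (cosh (n * τ) ^ 2 - (cosh τ ^ 2 + κ * (n - 1))) c c'
  rw [← modeExcess_eq] at h1
  have h2 := sinhDiv_ne_zero hτ n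
  have h3 : 0 < sinhDiv n τ ^ 2 := by positivity
  have h5 := mul_nonpos_of_nonneg_of_nonpos h3.le h0
  have hc : c = 0 := by
    by_contra hc
    have : 0 < ‖c‖ := norm_pos_iff.2 hc
    have h4 := mul_pos (sub_pos.2 h) (pow_pos this 2)
    have := sq_nonneg ‖((sinhDiv n τ ^ 2 : ℝ) : ℂ) * c' + ((sinhDiv n τ * cosh (n * τ) - sinh τ * cosh τ : ℝ) : ℂ) * c‖
    linarith
  refine ⟨hc, ?_⟩
  rw [h1, hc, norm_zero, mul_zero, add_zero] at h5
  have h6 : ‖((sinhDiv n τ ^ 2 : ℝ) : ℂ) * c'‖ ^ 2 = 0 := le_antisymm (by simpa using h5) (by positivity)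
  have h7 : ((sinhDiv n τ ^ 2 : ℝ) : ℂ) * c' = 0 := by simpa using h6
  rcases mul_eq_zero.1 h7 with h8 | h8
  · exact absurd h8 (by exact_mod_cast h3.ne')
  · exact h8

/-! ### Two admissible weights. -/

/-- The weight `κ` makes every mode other than `0` and `1` have positive excess after time `τ`. -/
def Admissible (κ τ : ℝ) : Prop := ∀ n : ℤ, n ≠ 0 → n ≠ 1 →
  (sinhDiv n τ * cosh (n * τ) - sinh τ * cosh τ) ^ 2
    < sinhDiv n τ ^ 2 * (cosh (n * τ) ^ 2 - (cosh τ ^ 2 + κ * (n - 1)))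

/-- Induction by the addition formula, using `cosh (m τ) cosh τ ≤ cosh ((m + 1) τ)`. -/
lemma sinh_nat_mul_le {τ : ℝ} (hτ : 0 ≤ τ) (m : ℕ) :
    sinh ((m + 1) * τ) ≤ (m + 1) * (sinh τ * cosh (m * τ)) := by
  induction m with
  | zero => simp
  | succ m ih =>
    have hs : 0 ≤ sinh τ := Real.sinh_nonneg_iff.2 hτ
    have h1 : 0 ≤ sinh (m * τ) := Real.sinh_nonneg_iff.2 (by positivity)
    have e : ((m : ℝ) + 1 + 1) * τ = (m + 1) * τ + τ := by ring
    have e2 : ((m : ℝ) + 1) * τ = m * τ + τ := by ring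
    push_cast
    rw [e, Real.sinh_add]
    have h2 : cosh (m * τ) * cosh τ ≤ cosh ((m + 1) * τ) := by
      rw [e2, Real.cosh_add]
      have := mul_nonneg h1 hs
      linarith
    have h3 := mul_le_mul_of_nonneg_right ih (Real.cosh_pos τ).le
    have h4 := mul_le_mul_of_nonneg_left h2 (show 0 ≤ ((m : ℝ) + 1) * sinh τ by positivity)
    nlinarith

lemma le_sinh_nat_mul {τ : ℝ} (hτ : 0 ≤ τ) (m : ℕ) :
    (m + 2) * (sinh τ * cosh τ) ≤ sinh ((m + 2) * τ) := by
  induction m with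
  | zero =>
    simp [Real.sinh_two_mul]
    linarith
  | succ m ih =>
    have hs : 0 ≤ sinh τ := Real.sinh_nonneg_iff.2 hτ
    have e : ((m : ℝ) + 1 + 2) * τ = (m + 2) * τ + τ := by ring
    push_cast
    rw [e, Real.sinh_add]
    have h1 : cosh τ ≤ cosh ((m + 2) * τ) := by
      rw [Real.cosh_le_cosh, abs_of_nonneg hτ, abs_of_nonneg (by positivity)]
      nlinarith [show 0 ≤ (m : ℝ) * τ by positivity]
    have h2 := mul_le_mul_of_nonneg_right ih (Real.cosh_pos τ).le
    have h3 := Real.one_le_cosh τ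
    have h4 := mul_le_mul_of_nonneg_right h1 hs
    have h5 : 0 ≤ ((m : ℝ) + 2) * (sinh τ * cosh τ) * (cosh τ - 1) := by
      have := Real.cosh_pos τ
      have : 0 ≤ cosh τ - 1 := by linarith
      positivity
    nlinarith

/-- It suffices to check admissibility for positive `n`. -/
lemma admissible_of_nat {κ τ : ℝ} (hτ : 0 < τ) (hκ : 0 < κ)
    (h : ∀ m : ℕ, ((m : ℝ) + 2) ^ 2 * (sinh τ * cosh τ) ^ 2
      + sinh ((m + 2) * τ) ^ 2 * (cosh τ ^ 2 + κ * (m + 1))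
        < 2 * (m + 2) * sinh ((m + 2) * τ) * cosh ((m + 2) * τ) * (sinh τ * cosh τ)) :
    Admissible κ τ := by
  -- This is the discriminant inequality expanded and multiplied by `m²`. The sign of `n` enters
  -- only through `κ (n - 1)`, which is smaller for `n = -m`; the value `m = 1` arises only from `n
  -- = -1`.
  have key : ∀ m : ℕ, 1 ≤ m → ∀ n : ℤ, (n = m ∧ m ≠ 1 ∨ n = -m) →
      (m : ℝ) ^ 2 * (sinh τ * cosh τ) ^ 2 + sinh (m * τ) ^ 2 * (cosh τ ^ 2 + κ * (n - 1))
        < 2 * m * sinh (m * τ) * cosh (m * τ) * (sinh τ * cosh τ) := by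
    intro m hm n hn
    have hs : 0 < sinh (m * τ) := Real.sinh_pos_iff.2 (by positivity)
    by_cases hm1 : m = 1
    · subst hm1
      have hn : n = -1 := by simpa using hn
      subst hn
      simp only [Nat.cast_one, one_mul] at hs ⊢
      have : 0 < sinh τ ^ 2 * κ := by positivity
      push_cast
      nlinarith
    · obtain ⟨k, rfl⟩ := Nat.exists_eq_add_of_le' (show 2 ≤ m by omega)
      have h1 := h k
      push_cast at hs ⊢
      refine lt_of_le_of_lt ?_ h1
      have : (n : ℝ) ≤ k + 2 := by
        rcases hn with ⟨hn, -⟩ | hn <;> rw [hn] <;> push_cast <;>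
          linarith [show (0 : ℝ) ≤ k from k.cast_nonneg]
      gcongr
      linarith
  have main : ∀ m : ℕ, 1 ≤ m → ∀ n : ℤ, (n = m ∧ m ≠ 1 ∨ n = -m) →
      (sinhDiv n τ * cosh (n * τ) - sinh τ * cosh τ) ^ 2
        < sinhDiv n τ ^ 2 * (cosh (n * τ) ^ 2 - (cosh τ ^ 2 + κ * (n - 1))) := by
    intro m hm n hn
    have hk := key m hm n hn
    have hm0 : (0 : ℝ) < m := by exact_mod_cast hm
    have eS : sinhDiv n τ = sinh (m * τ) / m := by
      unfold sinhDiv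
      rcases hn with ⟨rfl, -⟩ | rfl
      · rw [if_neg (by omega)]; simp
      · rw [if_neg (by omega)]
        push_cast
        rw [neg_mul, Real.sinh_neg, neg_div_neg_eq]
    have eC : cosh (n * τ) = cosh (m * τ) := by
      rcases hn with ⟨rfl, -⟩ | rfl
      · simp
      · push_cast; rw [neg_mul, Real.cosh_neg]
    rw [eS, eC, ← sub_pos]
    rw [← sub_pos] at hk
    have : (sinh (m * τ) / m) ^ 2 * (cosh (m * τ) ^ 2 - (cosh τ ^ 2 + κ * (n - 1)))
        - (sinh (m * τ) / m * cosh (m * τ) - sinh τ * cosh τ) ^ 2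
        = (2 * m * sinh (m * τ) * cosh (m * τ) * (sinh τ * cosh τ)
          - ((m : ℝ) ^ 2 * (sinh τ * cosh τ) ^ 2
            + sinh (m * τ) ^ 2 * (cosh τ ^ 2 + κ * (n - 1)))) / (m : ℝ) ^ 2 := by
      field_simp
      ring
    rw [this]
    positivity
  intro n h0 h1
  rcases lt_or_ge n 0 with hn | hn
  · exact main (-n).toNat (by omega) n (Or.inr (by omega))
  · exact main n.toNat (by omega) n (Or.inl ⟨by omega, by omega⟩)

lemma admissible_two_mul_sinh_sq {τ : ℝ} (hτ : 0 < τ) : Admissible (2 * sinh τ ^ 2) τ := by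
  have hs : 0 < sinh τ := Real.sinh_pos_iff.2 hτ
  have hc := Real.cosh_pos τ
  refine admissible_of_nat hτ (by positivity) fun m => ?_
  have ha : 0 < sinh ((m + 2) * τ) := Real.sinh_pos_iff.2 (by positivity)
  have h1 := sinh_nat_mul_le hτ.le (m + 1)
  have h2 := le_sinh_nat_mul hτ.le m
  have e : ((m : ℝ) + 2) * τ = (m + 1) * τ + τ := by ring
  have e1 : ((m : ℝ) + 1 + 1) = m + 2 := by ring
  push_cast at h1
  rw [e1] at h1
  have hC : cosh ((m + 1) * τ) = cosh ((m + 2) * τ) * cosh τ - sinh ((m + 2) * τ) * sinh τ := by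
    rw [show ((m : ℝ) + 1) * τ = (m + 2) * τ - τ by ring, Real.cosh_sub]
  rw [hC] at h1
  generalize sinh ((m + 2) * τ) = a at *
  generalize cosh ((m + 2) * τ) = C at *
  have hcs := cosh_sq τ
  have hc1 : 1 < cosh τ := Real.one_lt_cosh.2 hτ.ne'
  have hM : (0 : ℝ) < m + 2 := by positivity
  generalize hMdef : (m : ℝ) + 2 = M at *
  have hm1 : (m : ℝ) + 1 = M - 1 := by linarith
  rw [hm1]
  -- Here `a = sinh (M τ)` and `C = cosh (M τ)`. By `h4` the left side of the goal is at most `2 a²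
  -- (1 + M sinh² τ) - a² sinh² τ`, and by `h3` the right side is at least `2 a² (1 + M sinh² τ)`.
  have h3 : (1 + M * sinh τ ^ 2) * a ≤ M * (sinh τ * cosh τ) * C := by nlinarith
  have h4 : M ^ 2 * (sinh τ * cosh τ) ^ 2 ≤ a ^ 2 := by
    rw [← mul_pow]; gcongr
  have h5 := mul_le_mul_of_nonneg_left h3 (show 0 ≤ 2 * a by positivity)
  have h6 : 0 < a ^ 2 * sinh τ ^ 2 := by positivity
  rw [hcs]
  nlinarith

lemma one_lt_sinh_sq {τ : ℝ} (hτ : 1 ≤ τ) : 6 / 5 < sinh τ ^ 2 := by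
  have h1 : sinh 1 ≤ sinh τ := Real.sinh_le_sinh.2 hτ
  have h2 : 11 / 10 < sinh 1 := by
    rw [Real.sinh_eq, Real.exp_neg]
    have h3 := Real.exp_one_gt_d9
    have h4 : (Real.exp 1)⁻¹ < 0.4 := by
      rw [inv_lt_comm₀ (by positivity) (by norm_num)]
      linarith
    linarith
  nlinarith

lemma admissible_sinh_two_mul {τ : ℝ} (hτ : 1 ≤ τ) : Admissible (2 * (sinh τ * cosh τ)) τ := by
  have hτ0 : 0 < τ := by linarith
  have hs : 0 < sinh τ := Real.sinh_pos_iff.2 hτ0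
  have hc := Real.cosh_pos τ
  refine admissible_of_nat hτ0 (by positivity) fun m => ?_
  have ha : 0 < sinh ((m + 2) * τ) := Real.sinh_pos_iff.2 (by positivity)
  have h2 := le_sinh_nat_mul hτ0.le m
  have hac := Real.sinh_lt_cosh ((m + 2) * τ)
  generalize sinh ((m + 2) * τ) = a at *
  generalize cosh ((m + 2) * τ) = C at *
  have hcs := cosh_sq τ
  have hX := one_lt_sinh_sq hτ
  have hM : (0 : ℝ) < m + 2 := by positivity
  generalize hMdef : (m : ℝ) + 2 = M at *
  have hm1 : (m : ℝ) + 1 = M - 1 := by linarith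
  rw [hm1]
  -- After squaring this reads `4 < 3 sinh⁴ τ`, which is what the bound `6 / 5` on `sinh² τ`
  -- provides.
  have hμ : 2 + sinh τ ^ 2 < 2 * (sinh τ * cosh τ) := by
    refine lt_of_pow_lt_pow_left₀ 2 (by positivity) ?_
    rw [mul_pow, mul_pow, hcs]
    nlinarith
  have h4 : M ^ 2 * (sinh τ * cosh τ) ^ 2 ≤ a ^ 2 := by
    rw [← mul_pow]; gcongr
  have h5 : 2 * M * a * a * (sinh τ * cosh τ) ≤ 2 * M * a * C * (sinh τ * cosh τ) := by gcongr
  have h6 := mul_lt_mul_of_pos_left hμ (show 0 < a ^ 2 by positivity)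
  rw [hcs]
  nlinarith

end NitscheAnnuli
end

/-! ### Hyperbolic inequalities for the zeroth mode. -/

noncomputable section
namespace NitscheAnnuli

open MeasureTheory Set ComplexConjugate

open Real (sinh cosh sinh_sq cosh_sq)

/-- Equivalent to `sinh τ (cosh τ - τ) ≤ τ`, which follows from Taylor bounds for the two factors.
It makes the zeroth excess nonnegative for the weight `2 sinh² τ`. -/
lemma sinh_mul_cosh_le {τ : ℝ} (h0 : 0 ≤ τ) (h1 : τ ≤ 1) :
    sinh τ * cosh τ ≤ τ * (1 + sinh τ) := by
  have b1 := abs_le.1 (Real.exp_bound (x := τ) (by rwa [abs_of_nonneg h0]) (n := 5) (by norm_num))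
  have b2 := abs_le.1 (Real.exp_bound (x := -τ) (by rwa [abs_neg, abs_of_nonneg h0]) (n := 5)
    (by norm_num))
  simp only [Finset.sum_range_succ, Finset.sum_range_zero, abs_neg, abs_of_nonneg h0] at b1 b2
  norm_num [Nat.factorial] at b1 b2
  have t2 : τ ^ 2 ≤ τ := by nlinarith
  have t3 : τ ^ 3 ≤ τ ^ 2 := pow_le_pow_of_le_one h0 h1 (by norm_num)
  have t4 : τ ^ 4 ≤ τ ^ 3 := pow_le_pow_of_le_one h0 h1 (by norm_num)
  have t5 : τ ^ 5 ≤ τ ^ 4 := pow_le_pow_of_le_one h0 h1 (by norm_num)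
  have hs : sinh τ ≤ τ + τ ^ 3 / 5 := by
    rw [Real.sinh_eq]; nlinarith
  have hc : cosh τ - τ ≤ 1 - τ + 3 / 5 * τ ^ 2 := by
    rw [Real.cosh_eq]; nlinarith
  have hs0 := Real.sinh_nonneg_iff.2 h0
  have hsc : 0 ≤ cosh τ - τ := by linarith [Real.one_le_cosh τ]
  have := mul_le_mul hs hc hsc (by positivity)
  nlinarith [show 0 ≤ τ ^ 5 by positivity, show 0 ≤ τ ^ 4 by positivity]

/-- Nonnegativity of the excess of the zeroth mode in the range `τ ≤ 1`. -/
lemma zero_mode_of_le_one {τ : ℝ} (h0 : 0 < τ) (h1 : τ ≤ 1) :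
    (τ - sinh τ * cosh τ) ^ 2 ≤ τ ^ 2 * (2 * sinh τ ^ 2 - sinh τ ^ 2) := by
  have h2 := sinh_mul_cosh_le h0.le h1
  have h3 : τ ≤ sinh τ := Real.self_le_sinh_iff.2 h0.le
  have h4 := Real.one_le_cosh τ
  have h5 : 0 ≤ sinh τ * cosh τ - τ := by nlinarith
  have : (sinh τ * cosh τ - τ) ^ 2 ≤ (τ * sinh τ) ^ 2 := by
    gcongr
    linarith
  nlinarith

/-- The difference of the two sides is convex, so only the endpoints matter; at `3 / 2` the margin
is about `0.003`, hence the precise decimals. The term `exp (-3τ)` is there because `2 sinh τ cosh τ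
- sinh² τ = cosh² τ - exp (-2τ)`, whose square root is close to `cosh τ - exp (-3τ)`. -/
lemma sinh_mul_cosh_le_of_mem_Icc {τ : ℝ} (h : τ ∈ Icc (1 : ℝ) (3 / 2)) :
    sinh τ * cosh τ ≤ τ * (1 + cosh τ - Real.exp (-(3 * τ))) := by
  set D : ℝ → ℝ := fun τ => sinh τ * cosh τ - τ * (1 + cosh τ - Real.exp (-(3 * τ))) with hD
  set D' : ℝ → ℝ := fun τ => cosh τ ^ 2 + sinh τ ^ 2
    - (1 + cosh τ - Real.exp (-(3 * τ)) + τ * (sinh τ + 3 * Real.exp (-(3 * τ)))) with hD'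
  have he : ∀ t : ℝ, HasDerivAt (fun t : ℝ => Real.exp (-(3 * t))) (-3 * Real.exp (-(3 * t))) t := by
    intro t
    refine (((hasDerivAt_id' t).const_mul 3).neg.exp).congr_deriv ?_
    simp
    ring
  have d1 : ∀ t, HasDerivAt D (D' t) t := by
    intro t
    have := ((Real.hasDerivAt_sinh t).mul (Real.hasDerivAt_cosh t)).sub
      ((hasDerivAt_id' t).mul (((Real.hasDerivAt_cosh t).const_add 1).sub (he t)))
    refine this.congr_deriv ?_
    simp only [hD']
    simp
    ring
  have d2 : ∀ t, HasDerivAt D' (4 * sinh t * cosh t - 2 * sinh t - t * cosh t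
      + (9 * t - 6) * Real.exp (-(3 * t))) t := by
    intro t
    have := (((Real.hasDerivAt_cosh t).pow 2).add ((Real.hasDerivAt_sinh t).pow 2)).sub
      ((((Real.hasDerivAt_cosh t).const_add 1).sub (he t)).add ((hasDerivAt_id' t).mul
        ((Real.hasDerivAt_sinh t).add ((he t).const_mul 3))))
    refine this.congr_deriv ?_
    simp
    ring
  have hconv : ConvexOn ℝ (Icc (1 : ℝ) (3 / 2)) D := by
    refine convexOn_of_hasDerivWithinAt2_nonneg (convex_Icc _ _)
      (fun t _ => (d1 t).continuousAt.continuousWithinAt)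
      (fun t _ => (d1 t).hasDerivWithinAt) (fun t _ => (d2 t).hasDerivWithinAt) fun t ht => ?_
    rw [interior_Icc] at ht
    have h3 : t ≤ sinh t := Real.self_le_sinh_iff.2 (by linarith [ht.1])
    have h4 := Real.one_le_cosh t
    have h5 : 0 ≤ (9 * t - 6) * Real.exp (-(3 * t)) :=
      mul_nonneg (by linarith [ht.1]) (Real.exp_pos _).le
    have h6 : 0 ≤ t := by linarith [ht.1]
    nlinarith
  have e1 := Real.exp_one_gt_d9
  have e2 := Real.exp_one_lt_d9
  have D1 : D 1 ≤ 0 := by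
    have hw : Real.exp (-(3 * 1)) = (Real.exp 1)⁻¹ ^ 3 := by
      rw [← Real.exp_neg, ← Real.exp_nat_mul]; norm_num
    simp only [hD]
    rw [hw, Real.sinh_eq, Real.cosh_eq, Real.exp_neg]
    have i1 : (Real.exp 1)⁻¹ < 0.3679 := by
      rw [inv_lt_comm₀ (by positivity) (by norm_num)]
      norm_num; linarith
    have i2 : 0.3678 < (Real.exp 1)⁻¹ := by
      rw [lt_inv_comm₀ (by norm_num) (by positivity)]
      norm_num; linarith
    generalize (Real.exp 1)⁻¹ = w at *
    generalize Real.exp 1 = v at *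
    have i3 : w ^ 3 ≤ 0.3679 ^ 3 := by gcongr
    nlinarith
  have D2 : D (3 / 2) ≤ 0 := by
    have hw : Real.exp (-(3 * (3 / 2))) = (Real.exp (3 / 2))⁻¹ ^ 3 := by
      rw [← Real.exp_neg, ← Real.exp_nat_mul]; norm_num
    have hv : Real.exp (3 / 2) ^ 2 = Real.exp 1 ^ 3 := by
      rw [← Real.exp_nat_mul, ← Real.exp_nat_mul]; norm_num
    simp only [hD]
    rw [hw, Real.sinh_eq, Real.cosh_eq, Real.exp_neg]
    have v0 := Real.exp_pos (3 / 2)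
    have e3 : Real.exp 1 ^ 3 < 2.7182818286 ^ 3 := by gcongr
    have e4 : 2.7182818283 ^ 3 < Real.exp 1 ^ 3 := by gcongr
    rw [← hv] at e3 e4
    have v1 : 4.4816 < Real.exp (3 / 2) := by
      refine lt_of_pow_lt_pow_left₀ 2 v0.le (lt_trans ?_ e4); norm_num
    have v2 : Real.exp (3 / 2) < 4.4817 := by
      refine lt_of_pow_lt_pow_left₀ 2 (by norm_num) (e3.trans ?_); norm_num
    have i1 : (Real.exp (3 / 2))⁻¹ < 0.22314 := by
      rw [inv_lt_comm₀ (by positivity) (by norm_num)]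
      norm_num at v1 ⊢; linarith
    have i2 : 0.22312 < (Real.exp (3 / 2))⁻¹ := by
      rw [lt_inv_comm₀ (by norm_num) (by positivity)]
      norm_num at v2 ⊢; linarith
    generalize (Real.exp (3 / 2))⁻¹ = w at *
    generalize Real.exp (3 / 2) = v at *
    have i3 : w ^ 3 ≤ 0.22314 ^ 3 := by gcongr
    have i4 : 0.22312 ^ 2 ≤ w ^ 2 := by gcongr
    norm_num at *
    nlinarith
  have := hconv.le_max_of_mem_Icc (left_mem_Icc.2 (by norm_num)) (right_mem_Icc.2 (by norm_num)) h
  have : D τ ≤ 0 := this.trans (max_le D1 D2)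
  simp only [hD] at this
  linarith

/-- Nonnegativity of the excess of the zeroth mode in the range `1 ≤ τ ≤ 3 / 2`. -/
lemma zero_mode_of_mem_Icc {τ : ℝ} (h : τ ∈ Icc (1 : ℝ) (3 / 2)) :
    (τ - sinh τ * cosh τ) ^ 2 ≤ τ ^ 2 * (2 * (sinh τ * cosh τ) - sinh τ ^ 2) := by
  have hτ : 0 ≤ τ := by linarith [h.1]
  have h2 := sinh_mul_cosh_le_of_mem_Icc h
  have h3 : τ ≤ sinh τ := Real.self_le_sinh_iff.2 hτ
  have h4 := Real.one_le_cosh τ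
  have h5 : 0 ≤ sinh τ * cosh τ - τ := by nlinarith
  have h6 : (sinh τ * cosh τ - τ) ^ 2 ≤ (τ * (cosh τ - Real.exp (-(3 * τ)))) ^ 2 := by
    gcongr
    linarith
  have h7 : (cosh τ - Real.exp (-(3 * τ))) ^ 2 ≤ 2 * (sinh τ * cosh τ) - sinh τ ^ 2 := by
    have hw : Real.exp (-(3 * τ)) = Real.exp (-τ) ^ 3 := by
      rw [← Real.exp_nat_mul]; congr 1; push_cast; ring
    have hvw : Real.exp τ * Real.exp (-τ) = 1 := by rw [← Real.exp_add]; simp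
    have hw1 : Real.exp (-τ) ≤ 1 := Real.exp_le_one_iff.2 (by linarith)
    have hw0 := Real.exp_pos (-τ)
    rw [hw, Real.sinh_eq, Real.cosh_eq]
    generalize Real.exp (-τ) = w at *
    generalize Real.exp τ = v at *
    have e : 2 * ((v - w) / 2 * ((v + w) / 2)) - ((v - w) / 2) ^ 2 - ((v + w) / 2 - w ^ 3) ^ 2
        = w ^ 4 * (1 - w ^ 2) + (v * w - 1) * w ^ 2 := by ring
    have h8 : 0 ≤ 1 - w ^ 2 := by nlinarith
    have h9 : 0 ≤ w ^ 4 * (1 - w ^ 2) := by positivity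
    rw [hvw] at e
    linarith
  have h8 := mul_le_mul_of_nonneg_left h7 (sq_nonneg τ)
  nlinarith

/-! ### Fourier modes on the strip and the rigidity theorem. -/

namespace StripHarmonic

variable {T : ℝ} {F P Q L : ℝ → ℝ → ℂ}

lemma hasDerivAt_coeff {f g : ℝ → ℝ → ℂ} (hf : ContinuousOn (Function.uncurry f) (Ioo 0 T ×ˢ univ))
    (hg : ContinuousOn (Function.uncurry g) (Ioo 0 T ×ˢ univ))
    (hd : ∀ t ∈ Ioo 0 T, ∀ θ, HasDerivAt (fun s => f s θ) (g t θ) t) (n : ℤ) {t : ℝ}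
    (ht : t ∈ Ioo 0 T) : HasDerivAt (fun s => coeff (f s) n) (coeff (g t) n) t := by
  have hc : Continuous fun x : ℝ × ℝ => Complex.exp (-(n * (x.2 : ℂ) * Complex.I)) := by fun_prop
  refine hasDerivAt_mean (f := fun t θ => Complex.exp (-(n * (θ : ℂ) * Complex.I)) * f t θ)
    (f' := fun t θ => Complex.exp (-(n * (θ : ℂ) * Complex.I)) * g t θ) (a := 0) (b := T) ?_ ?_ ?_ ht
  · exact hc.continuousOn.mul hf
  · exact hc.continuousOn.mul hg
  · exact fun s hs θ => (hd s hs θ).const_mul _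

lemma coeff_Q (h : StripHarmonic T F P Q L) {t : ℝ} (ht : t ∈ Ioo 0 T) (n : ℤ) :
    coeff (Q t) n = n * Complex.I * coeff (F t) n :=
  coeff_deriv (h.derivF' t ht) (continuous_slice h.contQ ht) (h.perF t ht) n

lemma coeff_L (h : StripHarmonic T F P Q L) {t : ℝ} (ht : t ∈ Ioo 0 T) (n : ℤ) :
    coeff (L t) n = n ^ 2 * coeff (F t) n := by
  have h1 := coeff_deriv (h.derivQ t ht) (continuous_slice h.contL ht).neg (h.perQ t ht) n
  have h2 : coeff (fun θ => -L t θ) n = -coeff (L t) n := by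
    simpa using coeff_const_mul (-1) (L t) n
  rw [h2, h.coeff_Q ht] at h1
  linear_combination (-1 : ℂ) * h1 - n ^ 2 * coeff (F t) n * Complex.I_sq

lemma exists_coeff_eq (h : StripHarmonic T F P Q L) (hT : 0 < T) : ∃ p q : ℤ → ℂ,
    ∀ n, ∀ t ∈ Ioo 0 T, coeff (F t) n = p n * cosh (n * t) + q n * sinhDiv n t ∧
      coeff (P t) n = p n * (n ^ 2 * sinhDiv n t) + q n * cosh (n * t) := by
  have := fun n : ℤ => exists_eq_cosh_add_sinhDiv hT n (c := fun t => coeff (F t) n)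
    (d := fun t => coeff (P t) n) (fun t ht => hasDerivAt_coeff h.contF h.contP h.derivF n ht)
    (fun t ht => h.coeff_L ht n ▸ hasDerivAt_coeff h.contP h.contL h.derivP n ht)
  choose p q hpq using this
  exact ⟨p, q, hpq⟩

/-- Parseval for `Q` against `iF`: the `n`-th coefficient of `Q = F_θ` is `i n c_n`. -/
lemma hasSum_area (h : StripHarmonic T F P Q L) {t : ℝ} (ht : t ∈ Ioo 0 T) :
    HasSum (fun n : ℤ => n * ‖coeff (F t) n‖ ^ 2)
      (innerMean Q (fun t θ => Complex.I * F t θ) t) := by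
  have cF := continuous_slice h.contF ht
  have cQ := continuous_slice h.contQ ht
  unfold innerMean
  convert hasSum_re_coeff_mul_conj cQ (g := fun θ => Complex.I * F t θ) (by fun_prop) using 2 with n
  rw [h.coeff_Q ht, coeff_const_mul, ← Complex.normSq_eq_norm_sq, Complex.normSq_apply]
  simp
  ring


/-- If the excess of the zeroth mode is nonnegative for small `t`, then a harmonic function on the
strip of modulus between `1` and `cosh T` with the right boundary behaviour at `t = 0` and winding
number one reduces to a single Fourier mode. -/
theorem exists_eq_cosh_mul_exp (h : StripHarmonic T F P Q L) (hT : 0 < T)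
    (h1 : ∀ t ∈ Ioo 0 T, ∀ θ, 1 < ‖F t θ‖) (hR : ∀ t ∈ Ioo 0 T, ∀ θ, ‖F t θ‖ < cosh T)
    (hlim : ∀ δ > 0, ∀ᶠ t in 𝓝[>] (0 : ℝ), ∀ θ, ‖F t θ‖ ^ 2 ≤ 1 + δ)
    (hw : ∀ t ∈ Ioo 0 T, mean (fun θ => (Q t θ / F t θ).im) = 1)
    {κ : ℝ → ℝ} (hκc : Continuous κ) (hκ0 : ∀ t, 0 ≤ t → 0 ≤ κ t)
    (hadm : ∀ᶠ t in 𝓝[>] (0 : ℝ), Admissible (κ (T - t)) (T - t))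
    (hadmT : Admissible (κ T) T)
    (hzero : ∀ᶠ t in 𝓝[>] (0 : ℝ),
      0 ≤ modeExcess (κ (T - t)) (T - t) 0 (coeff (F t) 0) (coeff (P t) 0)) :
    ∃ α : ℂ, ∀ t ∈ Ioo 0 T, ∀ θ ∈ Icc 0 (2 * Real.pi),
      F t θ = α * cosh t * Complex.exp (θ * Complex.I) := by
  obtain ⟨p, q, hpq⟩ := h.exists_coeff_eq hT
  have hI : ∀ᶠ t in 𝓝[>] (0 : ℝ), t ∈ Ioo 0 T := Ioo_mem_nhdsGT hT
  have hU := h.tendsto_sqMean hT h1 hlim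
  have hSc : ∀ n, Continuous (sinhDiv n) := fun n =>
    continuous_iff_continuousAt.2 fun t => (hasDerivAt_sinhDiv n t).continuousAt
  have hS0 : ∀ n, sinhDiv n 0 = 0 := fun n => by unfold sinhDiv; simp
  have hc0 : ∀ n, Tendsto (fun t => coeff (F t) n) (𝓝[>] 0) (𝓝 (p n)) := fun n => by
    have := hSc n
    have : Tendsto (fun t : ℝ => p n * cosh (n * t) + q n * sinhDiv n t) (𝓝[>] 0) (𝓝 (p n)) :=
      (Continuous.tendsto' (by fun_prop) _ _ (by simp [hS0])).mono_left nhdsWithin_le_nhds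
    exact this.congr' (hI.mono fun t ht => (hpq n t ht).1.symm)
  have hd0 : ∀ n, Tendsto (fun t => coeff (P t) n) (𝓝[>] 0) (𝓝 (q n)) := fun n => by
    have := hSc n
    have : Tendsto (fun t : ℝ => p n * (n ^ 2 * sinhDiv n t) + q n * cosh (n * t)) (𝓝[>] 0)
        (𝓝 (q n)) :=
      (Continuous.tendsto' (by fun_prop) _ _ (by simp [hS0])).mono_left nhdsWithin_le_nhds
    exact this.congr' (hI.mono fun t ht => (hpq n t ht).2.symm)
  have hE0 : ∀ n, Tendsto (fun t => modeExcess (κ (T - t)) (T - t) n (coeff (F t) n)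
      (coeff (P t) n)) (𝓝[>] 0) (𝓝 (modeExcess (κ T) T n (p n) (q n))) := fun n => by
    have := hSc n
    have hc : Continuous fun x : ℝ × ℂ × ℂ =>
        modeExcess (κ (T - x.1)) (T - x.1) n x.2.1 x.2.2 := by
      unfold modeExcess
      fun_prop
    have h2 : Tendsto (fun t : ℝ => (t, coeff (F t) n, coeff (P t) n)) (𝓝[>] 0)
        (𝓝 (0, p n, q n)) :=
      (tendsto_id.mono_left nhdsWithin_le_nhds).prodMk_nhds ((hc0 n).prodMk_nhds (hd0 n))
    have := (hc.tendsto (0, p n, q n)).comp h2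
    rw [sub_zero] at this
    exact this
  -- The data at time `t`, propagated for time `T - t`, give the value at `T` of the extended mode.
  have hcT : ∀ n, ∀ t ∈ Ioo 0 T, coeff (F t) n * cosh (n * (T - t))
      + coeff (P t) n * sinhDiv n (T - t) = p n * cosh (n * T) + q n * sinhDiv n T := by
    intro n t ht
    obtain ⟨e1, e2⟩ := hpq n t ht
    have e3 := cosh_mul_add n t (T - t)
    have e4 := sinhDiv_add n t (T - t)
    rw [add_sub_cancel] at e3 e4
    rw [e1, e2, e3, e4]
    push_cast
    ring
  -- Bessel's inequality on circles `t < T`, then `t → T`. Finite sums suffice, and the limit may be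
  -- taken mode by mode.
  have hfin : ∀ S : Finset ℤ, ∑ n ∈ S, ‖p n * cosh (n * T) + q n * sinhDiv n T‖ ^ 2
      ≤ cosh T ^ 2 := by
    intro S
    have hlimT : Tendsto (fun t : ℝ => ∑ n ∈ S, ‖p n * cosh (n * t) + q n * sinhDiv n t‖ ^ 2)
        (𝓝[<] T) (𝓝 (∑ n ∈ S, ‖p n * cosh (n * T) + q n * sinhDiv n T‖ ^ 2)) :=
      (Continuous.tendsto (continuous_finsetSum _ fun n _ => by
        have := hSc n; fun_prop) T).mono_left nhdsWithin_le_nhds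
    refine le_of_tendsto hlimT ?_
    filter_upwards [Ioo_mem_nhdsLT hT] with t ht
    have cF := continuous_slice h.contF ht
    have hs := hasSum_sq_coeff cF
    calc ∑ n ∈ S, ‖p n * cosh (n * t) + q n * sinhDiv n t‖ ^ 2
        = ∑ n ∈ S, ‖coeff (F t) n‖ ^ 2 := Finset.sum_congr rfl fun n _ => by
          rw [(hpq n t ht).1]
      _ ≤ sqMean F t := sum_le_hasSum S (fun n _ => by positivity) hs
      _ ≤ mean fun _ => cosh T ^ 2 := mean_mono (by fun_prop) continuous_const fun θ => by
          have := (hR t ht θ).le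
          gcongr
      _ = cosh T ^ 2 := mean_const _
  -- All excesses being nonnegative, one of them is at most their sum over any finite set containing
  -- it. The remaining sums are passed to the limit by Parseval, and the term with `U' ≥ 0` is
  -- dropped.
  have hbound : ∀ n, ∀ᶠ t in 𝓝[>] (0 : ℝ),
      modeExcess (κ (T - t)) (T - t) n (coeff (F t) n) (coeff (P t) n)
        ≤ cosh T ^ 2 - cosh (T - t) ^ 2 * sqMean F t
          - κ (T - t) * (innerMean Q (fun t θ => Complex.I * F t θ) t - sqMean F t) := by
    intro n
    filter_upwards [hI, hadm, hzero] with t ht ha hz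
    have cF := continuous_slice h.contF ht
    have cP := continuous_slice h.contP ht
    have hτ : 0 < T - t := sub_pos.2 ht.2
    set τ := T - t with hτdef
    have hnn : ∀ m, 0 ≤ modeExcess (κ τ) τ m (coeff (F t) m) (coeff (P t) m) := by
      intro m
      by_cases hm0 : m = 0
      · rw [hm0]; exact hz
      by_cases hm1 : m = 1
      · refine modeExcess_nonneg hτ.ne' ?_ _ _
        simp [hm1, sinhDiv]
      exact modeExcess_nonneg hτ.ne' (ha m hm0 hm1).le _ _
    have hsum := (((hasSum_re_coeff_mul_conj cP cF).mul_left (2 * (sinh τ * cosh τ))).add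
      ((hasSum_sq_coeff cF).mul_left (cosh τ ^ 2))).add
      (((h.hasSum_area ht).sub (hasSum_sq_coeff cF)).mul_left (κ τ))
    have hge : ∀ S : Finset ℤ, n ∈ S →
        modeExcess (κ τ) τ n (coeff (F t) n) (coeff (P t) n) ≤ cosh T ^ 2
          - ∑ m ∈ S, (2 * (sinh τ * cosh τ) * (coeff (P t) m * conj (coeff (F t) m)).re
            + cosh τ ^ 2 * ‖coeff (F t) m‖ ^ 2
            + κ τ * (m * ‖coeff (F t) m‖ ^ 2 - ‖coeff (F t) m‖ ^ 2)) := by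
      intro S hS
      calc _ ≤ ∑ m ∈ S, modeExcess (κ τ) τ m (coeff (F t) m) (coeff (P t) m) :=
            Finset.single_le_sum (fun m _ => hnn m) hS
        _ = ∑ m ∈ S, ‖p m * cosh (m * T) + q m * sinhDiv m T‖ ^ 2
            - ∑ m ∈ S, (2 * (sinh τ * cosh τ) * (coeff (P t) m * conj (coeff (F t) m)).re
            + cosh τ ^ 2 * ‖coeff (F t) m‖ ^ 2
            + κ τ * (m * ‖coeff (F t) m‖ ^ 2 - ‖coeff (F t) m‖ ^ 2)) := by
              rw [← Finset.sum_sub_distrib]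
              refine Finset.sum_congr rfl fun m _ => ?_
              rw [← hcT m t ht, modeExcess]
              ring
        _ ≤ _ := sub_le_sub_right (hfin S) _
    have hle := ge_of_tendsto (tendsto_const_nhds.sub hsum)
      ((eventually_ge_atTop {n}).mono fun S hS => hge S (by simpa using hS))
    have hP0 : 0 ≤ innerMean P F t := by
      have h2 := h.sqMean_sub_one_le hU ht
      have h3 : 1 ≤ sqMean F t := by
        rw [← mean_const 1]
        exact mean_mono continuous_const (by fun_prop) fun θ => one_le_pow₀ (h1 t ht θ).le
      by_contra! hneg
      nlinarith [ht.1]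
    have hμ : 0 ≤ 2 * (sinh τ * cosh τ) * innerMean P F t := by
      have := Real.sinh_nonneg_iff.2 hτ.le
      have := Real.cosh_pos τ
      positivity
    refine hle.trans ?_
    change cosh T ^ 2 - (2 * (sinh τ * cosh τ) * innerMean P F t + cosh τ ^ 2 * sqMean F t
      + κ τ * (_ - sqMean F t)) ≤ _
    linarith
  have hκT : 0 ≤ κ T := hκ0 T hT.le
  have hnonpos : ∀ n, modeExcess (κ T) T n (p n) (q n) ≤ 0 := by
    intro n
    by_contra! hpos
    -- On circles where the area is at least `1 - δ`, the bound is at most a quantity tending to `κ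
    -- δ < e / 2`, while the excess tends to `e`.
    set e := modeExcess (κ T) T n (p n) (q n) with he
    set δ := e / (2 * (κ T + 1)) with hδ
    have hδ0 : 0 < δ := by positivity
    have hδe : κ T * δ < e / 2 := by
      rw [hδ, mul_div_assoc', div_lt_div_iff₀ (by positivity) (by positivity)]
      nlinarith
    have hlim2 : Tendsto (fun t => cosh T ^ 2 - cosh (T - t) ^ 2 * sqMean F t
        - κ (T - t) * (1 - δ - sqMean F t)) (𝓝[>] 0)
        (𝓝 (cosh T ^ 2 - cosh (T - 0) ^ 2 * 1 - κ (T - 0) * (1 - δ - 1))) := by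
      have k1 : Tendsto (fun t => cosh (T - t) ^ 2) (𝓝[>] 0) (𝓝 (cosh (T - 0) ^ 2)) :=
        (Continuous.tendsto (by fun_prop) 0).mono_left nhdsWithin_le_nhds
      have k2 : Tendsto (fun t => κ (T - t)) (𝓝[>] 0) (𝓝 (κ (T - 0))) :=
        (Continuous.tendsto (by fun_prop) 0).mono_left nhdsWithin_le_nhds
      exact (tendsto_const_nhds.sub (k1.mul hU)).sub (k2.mul (tendsto_const_nhds.sub hU))
    have hsmall := hlim2.eventually_lt_const (u := e / 2) (by rw [sub_zero]; linarith)
    have hbig := (hE0 n).eventually_const_lt (u := e / 2) (by linarith)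
    obtain ⟨t, hA, hs, hb, hbd, ht⟩ := ((h.frequently_area_ge hT h1 hlim hw hδ0).and_eventually
      (hsmall.and (hbig.and ((hbound n).and hI)))).exists
    have := mul_le_mul_of_nonneg_left hA (hκ0 (T - t) (by linarith [ht.2]))
    linarith
  have hne : ∀ n, n ≠ 0 → n ≠ 1 → p n = 0 ∧ q n = 0 := fun n hn0 hn1 =>
    eq_zero_of_modeExcess_nonpos hT.ne' (hadmT n hn0 hn1) (hnonpos n)
  have hq1 : q 1 = 0 := by
    have := hnonpos 1
    rw [modeExcess_eq] at this
    simp [sinhDiv] at this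
    have hs : 0 < sinh T := Real.sinh_pos_iff.2 hT
    by_contra hq
    have : 0 < ‖q 1‖ := norm_pos_iff.2 hq
    have : 0 < sinh T ^ 2 * ‖q 1‖ ^ 2 := by positivity
    linarith
  -- Only the modes `0` and `1` survive, and mode `0` does not contribute to the area.
  have hp1 : 1 ≤ ‖p 1‖ ^ 2 := by
    refine le_of_forall_sub_le fun δ hδ => ?_
    refine ge_of_tendsto_of_frequently ((hc0 1).norm.pow 2) ?_
    refine ((h.frequently_area_ge hT h1 hlim hw hδ).and_eventually hI).mono fun t ht => ?_
    obtain ⟨hA, ht⟩ := ht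
    have := (h.hasSum_area ht).unique (hasSum_single 1 fun n hn => by
      by_cases hn0 : n = 0
      · simp [hn0]
      · rw [(hpq n t ht).1, (hne n hn0 hn).1, (hne n hn0 hn).2]; simp)
    rw [this] at hA
    simpa using hA
  have hp0 : p 0 = 0 := by
    have hle : ‖p 0‖ ^ 2 + ‖p 1‖ ^ 2 ≤ 1 := by
      refine le_of_tendsto_of_tendsto (((hc0 0).norm.pow 2).add ((hc0 1).norm.pow 2)) hU ?_
      filter_upwards [hI] with t ht
      have := sum_le_hasSum {0, 1} (fun n _ => by positivity)
        (hasSum_sq_coeff (continuous_slice h.contF ht))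
      simpa [sqMean] using this
    have : ‖p 0‖ ^ 2 = 0 := le_antisymm (by linarith) (by positivity)
    simpa using this
  have hq0 : q 0 = 0 := by
    have := hnonpos 0
    rw [modeExcess_eq, hp0] at this
    simp [sinhDiv] at this
    by_contra hq
    have : 0 < ‖q 0‖ := norm_pos_iff.2 hq
    have : 0 < T ^ 2 * ‖q 0‖ ^ 2 := by positivity
    linarith
  refine ⟨p 1, fun t ht => eq_of_coeff_eq (continuous_slice h.contF ht) (by fun_prop) fun n => ?_⟩
  rw [coeff_const_mul, (hpq n t ht).1]
  by_cases hn1 : n = 1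
  · subst hn1
    rw [coeff_exp_one, hq1]
    simp
  · rw [coeff_exp_of_ne hn1]
    by_cases hn0 : n = 0
    · rw [hn0, hp0, hq0]; simp
    · rw [(hne n hn0 hn1).1, (hne n hn0 hn1).2]; simp

end StripHarmonic

end NitscheAnnuli
end

/-! ### Continuous logarithms on strips and circles. -/

noncomputable section
namespace NitscheAnnuli

open MeasureTheory Set ComplexConjugate

section lifts

/-- The difference of two continuous logarithms takes values in the discrete set `2πiℤ`. All
comparisons of winding numbers below rest on this. -/
lemma sub_eq_sub_of_exp_eq {X : Type*} [TopologicalSpace X] {s : Set X} (hs : IsPreconnected s)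
    {α β : X → ℂ} (hα : ContinuousOn α s) (hβ : ContinuousOn β s)
    (h : ∀ x ∈ s, Complex.exp (α x) = Complex.exp (β x)) {x y : X} (hx : x ∈ s) (hy : y ∈ s) :
    α x - β x = α y - β y := by
  have hpi : (Real.pi : ℂ) ≠ 0 := by exact_mod_cast Real.pi_ne_zero
  have h2 : ∀ x ∈ s, ∃ n : ℤ, α x - β x = n * (2 * Real.pi * Complex.I) := fun x hx => by
    obtain ⟨n, hn⟩ := Complex.exp_eq_exp_iff_exists_int.1 (h x hx)
    exact ⟨n, by rw [hn]; ring⟩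
  have key := hs.constant_of_mapsTo
    Int.isClosedEmbedding_coe_real.isInducing.isDiscrete_range
    (f := fun x => ((α x - β x) / (2 * Real.pi * Complex.I)).re)
    (Complex.continuous_re.comp_continuousOn ((hα.sub hβ).div_const _))
    (fun x hx => by
      obtain ⟨n, hn⟩ := h2 x hx
      refine ⟨n, ?_⟩
      simp only [hn]
      rw [mul_div_cancel_right₀ _ (by simp [hpi])]
      simp) hx hy
  obtain ⟨n, hn⟩ := h2 x hx
  obtain ⟨m, hm⟩ := h2 y hy
  simp only [hn, hm] at key
  rw [mul_div_cancel_right₀ _ (by simp [hpi]), mul_div_cancel_right₀ _ (by simp [hpi])] at key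
  rw [hn, hm]
  congr 1
  exact_mod_cast key

/-- The open vertical strip `a < Re z < b`. -/
def strip (a b : ℝ) : Set ℂ := {z | a < z.re ∧ z.re < b}

lemma convex_strip (a b : ℝ) : Convex ℝ (strip a b) :=
  (convex_halfSpace_re_gt a).inter (convex_halfSpace_re_lt b)

lemma isOpen_strip (a b : ℝ) : IsOpen (strip a b) :=
  (isOpen_lt continuous_const Complex.continuous_re).inter
    (isOpen_lt Complex.continuous_re continuous_const)

lemma add_mem_strip {a b : ℝ} {z : ℂ} (hz : z ∈ strip a b) (θ : ℝ) :
    z + θ * Complex.I ∈ strip a b := by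
  simpa [strip] using hz

/-- A nonvanishing function on a strip has a continuous logarithm, and if it is
`2πi`-periodic then the increment of the logarithm over a period is constant. -/
lemma exists_log_on_strip {a b : ℝ} (hab : a < b) {g : ℂ → ℂ} (hg : ContinuousOn g (strip a b))
    (h0 : ∀ z ∈ strip a b, g z ≠ 0)
    (hper : ∀ z ∈ strip a b, g (z + (2 * Real.pi : ℝ) * Complex.I) = g z) :
    ∃ Γ : ℂ → ℂ, ContinuousOn Γ (strip a b) ∧ (∀ z ∈ strip a b, Complex.exp (Γ z) = g z) ∧
      ∃ c, ∀ z ∈ strip a b, Γ (z + (2 * Real.pi : ℝ) * Complex.I) - Γ z = c := by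
  have hne : (strip a b).Nonempty :=
    ⟨((a + b) / 2 : ℝ), by simp only [strip, mem_ofPred_eq, Complex.ofReal_re]; constructor <;> linarith⟩
  have hsc : IsSimplyConnected (strip a b) := by
    have := (convex_strip a b).contractibleSpace hne
    exact (inferInstance : SimplyConnectedSpace (strip a b))
  obtain ⟨Γ, hΓ, hexp⟩ := Complex.exists_continuousOn_eqOn_exp_comp hsc (isOpen_strip a b) hg
    (by rintro ⟨z, hz, h⟩; exact h0 z hz h)
  obtain ⟨z₀, hz₀⟩ := hne
  refine ⟨Γ, hΓ, hexp, Γ (z₀ + (2 * Real.pi : ℝ) * Complex.I) - Γ z₀, fun z hz => ?_⟩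
  refine sub_eq_sub_of_exp_eq (convex_strip a b).isPreconnected
    (α := fun z => Γ (z + (2 * Real.pi : ℝ) * Complex.I)) (β := Γ)
    (hΓ.comp (by fun_prop) fun z hz => add_mem_strip hz _) hΓ (fun z hz => ?_) hz hz₀
  have e1 := hexp (add_mem_strip hz (2 * Real.pi))
  have e2 := hexp hz
  simp only [Function.comp_apply] at e1 e2
  rw [e1, e2, hper z hz]

/-- A continuous function on `[0, 2π]` with equal values at the endpoints factors through a
continuous function on the plane via the parametrization of a circle. -/
lemma exists_continuous_comp_circleMap (a : ℂ) {ε : ℝ} (hε : 0 < ε) {ψ : ℝ → ℂ}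
    (hψ : ContinuousOn ψ (Icc 0 (2 * Real.pi))) (h : ψ (2 * Real.pi) = ψ 0) :
    ∃ L : ℂ → ℂ, Continuous L ∧ ∀ θ ∈ Icc 0 (2 * Real.pi), L (circleMap a ε θ) = ψ θ := by
  have hpi := Real.pi_pos
  let π' : Icc 0 (2 * Real.pi) → Metric.sphere a ε := fun θ =>
    ⟨circleMap a ε θ, circleMap_mem_sphere a hε.le θ⟩
  have hπc : Continuous π' := by
    refine Continuous.subtype_mk ?_ _
    exact (continuous_circleMap a ε).comp continuous_subtype_val
  have hsurj : Function.Surjective π' := by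
    rintro ⟨z, hz⟩
    rw [← abs_of_pos hε, ← image_circleMap_Ioc] at hz
    obtain ⟨θ, hθ, rfl⟩ := hz
    exact ⟨⟨θ, Ioc_subset_Icc_self hθ⟩, Subtype.ext (by simp [π'])⟩
  -- A continuous surjection from a compact space onto a Hausdorff space is a quotient map, so `ψ`
  -- descends to the circle; Tietze's theorem then extends it to the plane.
  have hq : IsQuotientMap π' := (hπc.isClosedMap).isQuotientMap hπc hsurj
  have hfac : ∀ x y : Icc 0 (2 * Real.pi), π' x = π' y → ψ x = ψ y := by
    intro x y hxy
    have hxy : circleMap a ε x = circleMap a ε y := congrArg Subtype.val hxy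
    rw [circleMap_eq_circleMap_iff a hε.ne'] at hxy
    obtain ⟨n, hn⟩ := hxy
    have hx := x.2
    have hy := y.2
    have hn' : (x : ℝ) = y + n * (2 * Real.pi) := by
      have := congrArg Complex.im hn
      simpa using this
    have n1 : n ≤ 1 := by
      by_contra! hcon
      have : (2 : ℝ) ≤ n := by exact_mod_cast hcon
      nlinarith [hx.2, hy.1]
    have n2 : -1 ≤ n := by
      by_contra! hcon
      have : (n : ℝ) ≤ -2 := by exact_mod_cast (by omega : n ≤ -2)
      nlinarith [hx.1, hy.2]
    obtain rfl | rfl | rfl : n = -1 ∨ n = 0 ∨ n = 1 := by omega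
    · have e1 : (x : ℝ) = 0 := by push_cast at hn'; linarith [hx.1, hy.2]
      have e2 : (y : ℝ) = 2 * Real.pi := by push_cast at hn'; linarith [hx.1, hy.2]
      rw [e1, e2, h]
    · have e1 : (x : ℝ) = y := by simpa using hn'
      rw [e1]
    · have e1 : (x : ℝ) = 2 * Real.pi := by push_cast at hn'; linarith [hx.2, hy.1]
      have e2 : (y : ℝ) = 0 := by push_cast at hn'; linarith [hx.2, hy.1]
      rw [e1, e2, h]
  obtain ⟨σ, hσ⟩ := hsurj.hasRightInverse
  have hℓ : ∀ x : Icc 0 (2 * Real.pi), ψ (σ (π' x)) = ψ x := fun x => hfac _ _ (hσ (π' x))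
  let ℓ : C(Metric.sphere a ε, ℂ) := ⟨fun z => ψ (σ z), by
    rw [hq.continuous_iff]
    exact (continuousOn_iff_continuous_domRestrict.1 hψ).congr fun x => (hℓ x).symm⟩
  obtain ⟨L, hL⟩ := ℓ.exists_restrict_eq Metric.isClosed_sphere
  refine ⟨L, L.continuous, fun θ hθ => ?_⟩
  exact (congrArg (fun f : C(Metric.sphere a ε, ℂ) => f (π' ⟨θ, hθ⟩)) hL).trans (hℓ ⟨θ, hθ⟩)

end lifts

end NitscheAnnuli
end

/-! ### Behaviour of the homeomorphism near the two boundary circles. -/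

noncomputable section
namespace NitscheAnnuli

open MeasureTheory Set ComplexConjugate

lemma exp_mem_annulus {R : ℝ} (hR : 1 < R) {z : ℂ} (hz : z ∈ strip 0 (Real.log R)) :
    Complex.exp z ∈ annulus 1 R := by
  have h1 := Real.exp_lt_exp.2 hz.1
  have h2 := Real.exp_lt_exp.2 hz.2
  rw [Real.exp_zero] at h1
  rw [Real.exp_log (by linarith)] at h2
  rw [annulus, mem_ofPred_eq, Complex.norm_exp]
  exact ⟨h1, h2⟩

lemma isOpen_annulus (r R : ℝ) : IsOpen (annulus r R) :=
  (isOpen_lt continuous_const continuous_norm).inter (isOpen_lt continuous_norm continuous_const)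

lemma exp_add_two_pi_mul_I (z : ℂ) :
    Complex.exp (z + (2 * Real.pi : ℝ) * Complex.I) = Complex.exp z := by
  have := Complex.exp_periodic z
  push_cast
  exact this

section homeo

variable {h : ℂ → ℂ} {R Rs : ℝ}

lemma mem_annulus_of_isHomeoOn {U V : Set ℂ} (hh : IsHomeoOn h U V) {z : ℂ} (hz : z ∈ U) :
    h z ∈ V := by
  obtain ⟨e, he⟩ := hh
  rw [← he ⟨z, hz⟩]
  exact (e ⟨z, hz⟩).2

lemma injOn_of_isHomeoOn {U V : Set ℂ} (hh : IsHomeoOn h U V) : InjOn h U := by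
  obtain ⟨e, he⟩ := hh
  intro x hx y hy hxy
  have : e ⟨x, hx⟩ = e ⟨y, hy⟩ := Subtype.ext (by rw [he, he]; exact hxy)
  exact congrArg Subtype.val (e.injective this)

lemma surjOn_of_isHomeoOn {U V : Set ℂ} (hh : IsHomeoOn h U V) : SurjOn h U V := by
  obtain ⟨e, he⟩ := hh
  intro w hw
  obtain ⟨z, hz⟩ := e.surjective ⟨w, hw⟩
  exact ⟨z, z.2, by rw [← he z, hz]⟩

lemma isCompact_preimage_of_isHomeoOn {U V K : Set ℂ} (hh : IsHomeoOn h U V) (hK : IsCompact K)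
    (hKV : K ⊆ V) : IsCompact (U ∩ h ⁻¹' K) := by
  obtain ⟨e, he⟩ := hh
  have h1 : IsCompact (Subtype.val ⁻¹' K : Set V) :=
    Topology.IsInducing.subtypeVal.isCompact_preimage_iff (by simpa using hKV) |>.2 hK
  convert (h1.image e.symm.continuous).image continuous_subtype_val using 1
  ext z
  constructor
  · rintro ⟨hz, hzK⟩
    refine ⟨⟨z, hz⟩, ⟨e ⟨z, hz⟩, ?_, by simp⟩, rfl⟩
    rw [mem_preimage, he]
    exact hzK
  · rintro ⟨x, ⟨y, hy, rfl⟩, rfl⟩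
    refine ⟨(e.symm y).2, ?_⟩
    rw [mem_preimage, ← he]
    simpa using hy

/-- Near the inner circle the values of `h` are close to the inner circle. -/
lemma exists_norm_lt_near_inner (hmaps : ∀ z ∈ annulus 1 R, h z ∈ annulus 1 Rs)
    (hcl : clusterSet h (annulus 1 R) (Metric.sphere 0 1) = Metric.sphere 0 1) {c : ℝ}
    (hc : 1 < c) : ∃ ρ > 1, ∀ z ∈ annulus 1 R, ‖z‖ < ρ → ‖h z‖ < c := by
  have hev : ∀ᶠ z in 𝓝ˢ (Metric.sphere (0 : ℂ) 1) ⊓ 𝓟 (annulus 1 R), ‖h z‖ < c := by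
    by_contra hcon
    have hfreq : ∃ᶠ z in 𝓝ˢ (Metric.sphere (0 : ℂ) 1) ⊓ 𝓟 (annulus 1 R),
        h z ∈ Metric.closedBall 0 Rs \ Metric.ball 0 c := by
      refine (Filter.Frequently.and_eventually (not_eventually.1 hcon)
        (Filter.eventually_of_mem (Filter.mem_inf_of_right (Filter.mem_principal_self _))
          (fun z hz => hmaps z hz))).mono fun z hz => ?_
      have h2 := hz.2.2.le
      have h1 := not_lt.1 hz.1
      simpa using ⟨h2, h1⟩
    obtain ⟨w, hw, hmw⟩ := ((isCompact_closedBall (0 : ℂ) Rs).diff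
      Metric.isOpen_ball).exists_mapClusterPt_of_frequently hfreq
    have : w ∈ clusterSet h (annulus 1 R) (Metric.sphere 0 1) := hmw
    rw [hcl, mem_sphere_zero_iff_norm] at this
    have h2 := hw.2
    rw [mem_ball_zero_iff, this] at h2
    exact h2 hc
  rw [Filter.eventually_inf_principal, Filter.eventually_iff, mem_nhdsSet_iff_exists] at hev
  obtain ⟨U, hUo, hSU, hU⟩ := hev
  obtain ⟨δ, hδ, hδU⟩ := (isCompact_sphere (0 : ℂ) 1).exists_thickening_subset_open hUo hSU
  refine ⟨1 + δ, by linarith, fun z hz hzρ => hU (hδU ?_) hz⟩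
  have hz0 : (0 : ℝ) < ‖z‖ := lt_trans one_pos hz.1
  refine Metric.mem_thickening_iff.2 ⟨z / ‖z‖, by simp [hz0.ne'], ?_⟩
  have e : z - z / ‖z‖ = z / ‖z‖ * ((‖z‖ - 1 : ℝ) : ℂ) := by
    have : (‖z‖ : ℂ) ≠ 0 := by exact_mod_cast hz0.ne'
    push_cast
    field_simp
  rw [dist_eq_norm, e, norm_mul, Complex.norm_real, Real.norm_of_nonneg (by linarith [hz.1])]
  simp [hz0.ne']
  linarith

/-- Near the outer circle there are circles on which `‖h‖` is large. -/
lemma exists_circle_near_outer (hR : 1 < R) (hcont : ContinuousOn h (annulus 1 R))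
    (hh : IsHomeoOn h (annulus 1 R) (annulus 1 Rs))
    (hcl : clusterSet h (annulus 1 R) (Metric.sphere 0 1) = Metric.sphere 0 1) {c r : ℝ}
    (hc : 1 < c) (hcR : c < Rs) (hr : r < R) :
    ∃ ρ, 1 < ρ ∧ r < ρ ∧ ρ < R ∧ ∀ z, ‖z‖ = ρ → c < ‖h z‖ := by
  obtain ⟨ρ₁, hρ₁, hin⟩ :=
    exists_norm_lt_near_inner (fun z hz => mem_annulus_of_isHomeoOn hh hz) hcl hc
  -- The level set `‖h‖ = c` is compact in the annulus, hence stays away from the outer circle.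
  obtain ⟨r', hr1, hrr, hrR, hr'⟩ : ∃ r', 1 < r' ∧ r < r' ∧ r' < R ∧
      ∀ z ∈ annulus 1 R, ‖h z‖ = c → ‖z‖ ≤ r' := by
    have hK : IsCompact (annulus 1 R ∩ h ⁻¹' Metric.sphere 0 c) :=
      isCompact_preimage_of_isHomeoOn hh (isCompact_sphere 0 c) fun w hw => by
        rw [mem_sphere_zero_iff_norm] at hw
        exact ⟨by rw [hw]; exact hc, by rw [hw]; exact hcR⟩
    obtain ⟨m, hm1, hm2⟩ := exists_between (max_lt hr hR)
    rcases (annulus 1 R ∩ h ⁻¹' Metric.sphere 0 c).eq_empty_or_nonempty with hemp | hne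
    · refine ⟨m, (le_max_right _ _).trans_lt hm1, (le_max_left _ _).trans_lt hm1, hm2,
        fun z hz hzc => ?_⟩
      have : z ∈ annulus 1 R ∩ h ⁻¹' Metric.sphere 0 c := ⟨hz, by simpa using hzc⟩
      rw [hemp] at this
      exact this.elim
    · obtain ⟨z₀, hz₀, hmax⟩ := hK.exists_isMaxOn hne continuous_norm.continuousOn
      refine ⟨max m ‖z₀‖, ((le_max_right _ _).trans_lt hm1).trans_le (le_max_left _ _),
        ((le_max_left _ _).trans_lt hm1).trans_le (le_max_left _ _), max_lt hm2 hz₀.1.2,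
        fun z hz hzc => le_max_of_le_right (isMaxOn_iff.1 hmax z ⟨hz, by simpa using hzc⟩)⟩
  obtain ⟨ρ, hρ1, hρ2⟩ := exists_between hrR
  refine ⟨ρ, hr1.trans hρ1, hrr.trans hρ1, hρ2, ?_⟩
  -- The region `r' < ‖z‖ < R` is connected, as the image of a strip under `exp`, and misses the
  -- level set, so `‖h‖ - c` has constant sign there.
  have hpre : ∀ z w, r' < ‖z‖ → ‖z‖ < R → r' < ‖w‖ → ‖w‖ < R → ‖h z‖ ≤ c → ‖h w‖ < c := by
    intro z w hz1 hz2 hw1 hw2 hzc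
    by_contra! hwc
    have hlog : ∀ x : ℂ, r' < ‖x‖ → ‖x‖ < R → Complex.log x ∈ strip (Real.log r') (Real.log R) ∧
        Complex.exp (Complex.log x) = x := fun x hx1 hx2 => by
      have hx0 : 0 < ‖x‖ := by linarith
      refine ⟨?_, Complex.exp_log (norm_pos_iff.1 hx0)⟩
      rw [strip, mem_ofPred_eq, Complex.log_re]
      exact ⟨Real.log_lt_log (by linarith) hx1, Real.log_lt_log hx0 hx2⟩
    have hexp : ∀ x ∈ strip (Real.log r') (Real.log R),
        Complex.exp x ∈ annulus 1 R ∧ r' < ‖Complex.exp x‖ := fun x hx => by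
      have h1 := Real.exp_lt_exp.2 hx.1
      have h2 := Real.exp_lt_exp.2 hx.2
      rw [Real.exp_log (by linarith)] at h1 h2
      rw [annulus, mem_ofPred_eq, Complex.norm_exp]
      exact ⟨⟨hr1.trans h1, h2⟩, h1⟩
    have hct : ContinuousOn (fun x => ‖h (Complex.exp x)‖) (strip (Real.log r') (Real.log R)) :=
      (hcont.comp Complex.continuous_exp.continuousOn fun x hx => (hexp x hx).1).norm
    obtain ⟨lz, ez⟩ := hlog z hz1 hz2
    obtain ⟨lw, ew⟩ := hlog w hw1 hw2
    obtain ⟨x, hx, hxc⟩ := (convex_strip _ _).isPreconnected.intermediate_value lz lw hct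
      (show c ∈ Icc _ _ by simp only [ez, ew]; exact ⟨hzc, hwc⟩)
    exact absurd (hr' _ (hexp x hx).1 hxc) (not_le.2 (hexp x hx).2)
  by_contra! hcon
  obtain ⟨z₀, hz₀, hz₀c⟩ := hcon
  -- If that sign were negative, `‖h‖ ≥ c` would confine points to a compact annulus, on which `‖h‖`
  -- has a maximum below `Rs`; this contradicts surjectivity.
  have hall : ∀ w ∈ annulus 1 R, c ≤ ‖h w‖ → w ∈ {w : ℂ | ρ₁ ≤ ‖w‖ ∧ ‖w‖ ≤ r'} := by
    intro w hw hwc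
    refine ⟨?_, ?_⟩
    · by_contra! hlt
      exact absurd (hin w hw hlt) (not_lt.2 hwc)
    · by_contra! hlt
      exact absurd (hpre z₀ w (hz₀ ▸ hρ1) (hz₀ ▸ hρ2) hlt hw.2 hz₀c) (not_lt.2 hwc)
  have hBc : IsCompact {w : ℂ | ρ₁ ≤ ‖w‖ ∧ ‖w‖ ≤ r'} := by
    refine Metric.isCompact_of_isClosed_isBounded
      ((isClosed_le continuous_const continuous_norm).inter
        (isClosed_le continuous_norm continuous_const)) ?_
    exact (Metric.isBounded_closedBall (x := (0 : ℂ)) (r := r')).subset fun w hw => by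
      simpa using hw.2
  have hBA : {w : ℂ | ρ₁ ≤ ‖w‖ ∧ ‖w‖ ≤ r'} ⊆ annulus 1 R := fun w hw =>
    ⟨lt_of_lt_of_le hρ₁ hw.1, lt_of_le_of_lt hw.2 hrR⟩
  have hreal : ∀ x : ℝ, c ≤ x → x < Rs → ∃ w ∈ {w : ℂ | ρ₁ ≤ ‖w‖ ∧ ‖w‖ ≤ r'}, ‖h w‖ = x := by
    intro x hx1 hx2
    have hxn : ‖(x : ℂ)‖ = x := by rw [Complex.norm_real, Real.norm_of_nonneg (by linarith)]
    obtain ⟨w, hw, hwx⟩ := surjOn_of_isHomeoOn hh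
      (show (x : ℂ) ∈ annulus 1 Rs from ⟨by rw [hxn]; linarith, by rw [hxn]; exact hx2⟩)
    exact ⟨w, hall w hw (by rw [hwx, hxn]; exact hx1), by rw [hwx, hxn]⟩
  obtain ⟨w₁, hw₁, -⟩ := hreal c le_rfl hcR
  obtain ⟨w₂, hw₂, hmax⟩ := hBc.exists_isMaxOn ⟨w₁, hw₁⟩ (hcont.mono hBA).norm
  obtain ⟨x, hx1, hx2⟩ := exists_between
    (max_lt hcR (mem_annulus_of_isHomeoOn hh (hBA hw₂)).2)
  obtain ⟨w₃, hw₃, e⟩ := hreal x ((le_max_left _ _).trans hx1.le) hx2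
  have h1 : ‖h w₃‖ ≤ ‖h w₂‖ := hmax hw₃
  have h2 := (le_max_right c ‖h w₂‖).trans_lt hx1
  linarith

end homeo

end NitscheAnnuli
end

/-! ### From local orientation to the winding number along concentric circles. -/

noncomputable section
namespace NitscheAnnuli

open MeasureTheory Set ComplexConjugate

/-- If `f - f a` winds once around a circle centred at `a`, then `(f z - f a) / (z - a)` can be
modified inside the circle to a continuous nonvanishing function. -/
lemma exists_nonvanishing_quotient {f : ℂ → ℂ} {U : Set ℂ} (hf : ContinuousOn f U)
    {a : ℂ} (hinj : ∀ z ∈ U, f z = f a → z = a) {ε : ℝ} (hε : 0 < ε)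
    (hwind : HasWindingNumber (fun θ => f (circleMap a ε θ) - f a) 1) :
    ∃ g : ℂ → ℂ, ContinuousOn g U ∧ (∀ z ∈ U, g z ≠ 0) ∧
      ∀ z ∉ Metric.closedBall a ε, f z - f a = g z * (z - a) := by
  classical
  obtain ⟨φ, hφc, hφ, hφ1⟩ := hwind
  -- On the circle the quotient `(f z - f a) / (z - a)` has winding number `1 - 1 = 0`, so its
  -- logarithm is single valued there and extends into the disc.
  obtain ⟨L, hL, hLψ⟩ := exists_continuous_comp_circleMap a hε
    (ψ := fun θ => φ θ - (Real.log ε + θ * Complex.I)) (hφc.sub (by fun_prop)) (by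
      push_cast at hφ1 ⊢
      linear_combination hφ1)
  refine ⟨(Metric.closedBall a ε).piecewise (fun z => Complex.exp (L z))
    (fun z => (f z - f a) / (z - a)), ?_, ?_, ?_⟩
  · refine ContinuousOn.piecewise (fun z hz => ?_) (by fun_prop) ?_
    · rw [frontier_closedBall _ hε.ne', ← abs_of_pos hε, ← image_circleMap_Ioc] at hz
      obtain ⟨-, θ, hθ, rfl⟩ := hz
      rw [hLψ θ (Ioc_subset_Icc_self hθ), Complex.exp_sub,
        hφ θ (Ioc_subset_Icc_self hθ), Complex.exp_add, ← Complex.ofReal_exp, Real.exp_log hε]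
      simp [circleMap]
    · refine ContinuousOn.div ((hf.mono inter_subset_left).sub continuousOn_const)
        (by fun_prop) ?_
      rintro z ⟨-, hz⟩ h0
      rw [sub_eq_zero] at h0
      have : z ∈ (Metric.ball a ε)ᶜ :=
        closure_minimal (compl_subset_compl.2 Metric.ball_subset_closedBall)
          Metric.isOpen_ball.isClosed_compl hz
      exact this (by rw [h0]; exact Metric.mem_ball_self hε)
  · intro z hz
    by_cases hzb : z ∈ Metric.closedBall a ε
    · rw [piecewise_eq_of_mem _ _ _ hzb]
      exact Complex.exp_ne_zero _
    · rw [piecewise_eq_of_notMem _ _ _ hzb]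
      have : z ≠ a := by rintro rfl; exact hzb (Metric.mem_closedBall_self hε.le)
      exact div_ne_zero (sub_ne_zero.2 fun h => this (hinj z hz h)) (sub_ne_zero.2 this)
  · intro z hzb
    have : z ≠ a := by rintro rfl; exact hzb (Metric.mem_closedBall_self hε.le)
    rw [piecewise_eq_of_notMem _ _ _ hzb, div_mul_cancel₀ _ (sub_ne_zero.2 this)]

lemma one_sub_mem_slitPlane {u : ℂ} (hu : ‖u‖ < 1) : 1 - u ∈ Complex.slitPlane := by
  have := Complex.mem_slitPlane_of_norm_lt_one (z := -u) (by simpa using hu)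
  rwa [← sub_eq_add_neg] at this

/-- A harmonic homeomorphism of annuli which takes the inner circle to the inner circle and
preserves orientation has winding number one along concentric circles. -/
theorem exists_log_comp_exp {h : ℂ → ℂ} {R Rs : ℝ} (hR : 1 < R)
    (hcont : ContinuousOn h (annulus 1 R))
    (hh : IsHomeoOn h (annulus 1 R) (annulus 1 Rs))
    (hor : PreservesOrientationOn h (annulus 1 R))
    (hcl : clusterSet h (annulus 1 R) (Metric.sphere 0 1) = Metric.sphere 0 1) :
    ∃ Φ : ℂ → ℂ, ContinuousOn Φ (strip 0 (Real.log R)) ∧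
      (∀ z ∈ strip 0 (Real.log R), Complex.exp (Φ z) = h (Complex.exp z)) ∧
      ∀ z ∈ strip 0 (Real.log R),
        Φ (z + (2 * Real.pi : ℝ) * Complex.I) - Φ z = 2 * Real.pi * Complex.I := by
  have hmaps : ∀ z ∈ annulus 1 R, h z ∈ annulus 1 Rs := fun z hz => mem_annulus_of_isHomeoOn hh hz
  have hT : 0 < Real.log R := Real.log_pos hR
  have hexpc : ∀ {g : ℂ → ℂ}, ContinuousOn g (annulus 1 R) →
      ContinuousOn (fun z => g (Complex.exp z)) (strip 0 (Real.log R)) := fun hg =>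
    hg.comp Complex.continuous_exp.continuousOn fun z hz => exp_mem_annulus hR hz
  obtain ⟨x, hx1, hx2⟩ := exists_between hR
  obtain ⟨a, ha⟩ : ∃ a : ℂ, a = (x : ℂ) := ⟨_, rfl⟩
  have hax : ‖a‖ = x := by rw [ha, Complex.norm_real, Real.norm_of_nonneg (by linarith)]
  have haA : a ∈ annulus 1 R := ⟨by rw [hax]; exact hx1, by rw [hax]; exact hx2⟩
  obtain ⟨ε, hε, hεA⟩ := Metric.nhds_basis_closedBall.mem_iff.1
    ((isOpen_annulus 1 R).mem_nhds haA)
  -- As `g` has no zeros in the annulus, its increment of logarithm `k` is the same on all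
  -- concentric circles. Near the inner circle `h - h a` and `z - a` are nonzero constants times `1
  -- - u` with `|u| < 1`, so `k = 0`. Near the outer circle they are `h` and `z` times such factors,
  -- so `h` winds once more than `g`.
  obtain ⟨g, hgc, hg0, hg⟩ := exists_nonvanishing_quotient hcont
    (fun z hz e => injOn_of_isHomeoOn hh hz haA e) hε (hor a ε hε hεA)
  have hout : ∀ z : ℂ, x + ε < ‖z‖ → z ∉ Metric.closedBall a ε := fun z hz hzb => by
    rw [mem_closedBall_iff_norm] at hzb
    have := norm_le_norm_add_norm_sub' z a
    linarith
  have hin : ∀ z : ℂ, ‖z‖ < x - ε → z ∉ Metric.closedBall a ε := fun z hz hzb => by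
    rw [mem_closedBall_iff_norm'] at hzb
    have := norm_le_norm_add_norm_sub' a z
    linarith
  obtain ⟨Γ, hΓc, hΓ, k, hk⟩ := exists_log_on_strip hT (hexpc hgc)
    (fun z hz => hg0 _ (exp_mem_annulus hR hz)) fun z _ => by rw [exp_add_two_pi_mul_I]
  have hh0 : ∀ z ∈ annulus 1 R, h z ≠ 0 := fun z hz h0 => by
    have := (hmaps z hz).1
    rw [h0, norm_zero] at this
    linarith
  obtain ⟨Φ, hΦc, hΦ, m, hm⟩ := exists_log_on_strip hT (hexpc hcont)
    (fun z hz => hh0 _ (exp_mem_annulus hR hz)) fun z _ => by rw [exp_add_two_pi_mul_I]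
  refine ⟨Φ, hΦc, hΦ, ?_⟩
  have hline : ∀ {s : ℝ}, 1 < s → s < R → ∀ θ : ℝ,
      (Real.log s : ℂ) + θ * Complex.I ∈ strip 0 (Real.log R) ∧
      ‖Complex.exp (Real.log s + θ * Complex.I)‖ = s := by
    intro s h1 h2 θ
    have h0 : 0 < s := by linarith
    refine ⟨add_mem_strip ⟨?_, ?_⟩ θ, ?_⟩
    · simpa using Real.log_pos h1
    · simpa using Real.log_lt_log h0 h2
    · simp [Complex.norm_exp, Real.exp_log h0]
  have hlinec : ∀ {s : ℝ}, 1 < s → s < R → ∀ {G : ℂ → ℂ}, ContinuousOn G (strip 0 (Real.log R)) →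
      Continuous fun θ : ℝ => G (Real.log s + θ * Complex.I) := fun h1 h2 G hG =>
    hG.comp_continuous (by fun_prop) fun θ => (hline h1 h2 θ).1
  have hper : ∀ s : ℝ, Complex.exp (Real.log s + (2 * Real.pi : ℝ) * Complex.I)
      = Complex.exp (Real.log s + (0 : ℝ) * Complex.I) := fun s => by
    rw [exp_add_two_pi_mul_I]; simp
  have hw0 := (hmaps a haA).1
  have hw0' : h a ≠ 0 := hh0 a haA
  have ha0 : a ≠ 0 := norm_pos_iff.1 (by rw [hax]; linarith)
  -- the winding number of the quotient vanishes on a circle near the inner boundary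
  have hk0 : k = 0 := by
    obtain ⟨ρ, hρ, hρin⟩ := exists_norm_lt_near_inner hmaps hcl hw0
    have hxε : 1 < x - ε := by
      have h1 : a - ε ∈ Metric.closedBall a ε := by
        rw [mem_closedBall_iff_norm]; simp [abs_of_pos hε]
      have h2 := (hεA h1).1
      have h3 : a - ε = ((x - ε : ℝ) : ℂ) := by rw [ha]; push_cast; ring
      rw [h3, Complex.norm_real, Real.norm_eq_abs] at h2
      have h4 : (0 : ℂ) ∉ Metric.closedBall a ε := fun h0 => by
        have := (hεA h0).1; rw [norm_zero] at this; linarith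
      rw [mem_closedBall_iff_norm', sub_zero, hax, not_le] at h4
      rwa [abs_of_pos (by linarith)] at h2
    obtain ⟨s, hs1, hs2⟩ := exists_between (lt_min hρ (lt_min hxε hR))
    rw [lt_min_iff, lt_min_iff] at hs2
    obtain ⟨hsρ, hsx, hsR⟩ := hs2
    have hl := hline hs1 hsR
    have u1 : ∀ θ : ℝ, ‖h (Complex.exp (Real.log s + θ * Complex.I)) / h a‖ < 1 := fun θ => by
      rw [norm_div, div_lt_one (by linarith)]
      exact hρin _ (exp_mem_annulus hR (hl θ).1) (by rw [(hl θ).2]; exact hsρ)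
    have u2 : ∀ θ : ℝ, ‖Complex.exp (Real.log s + θ * Complex.I) / a‖ < 1 := fun θ => by
      rw [norm_div, div_lt_one (by rw [hax]; linarith), (hl θ).2, hax]
      linarith
    have key := sub_eq_sub_of_exp_eq (s := univ) isPreconnected_univ
      (α := fun θ : ℝ => Γ (Real.log s + θ * Complex.I))
      (β := fun θ : ℝ => Complex.log (-h a) + Complex.log (1 - h (Complex.exp (Real.log s + θ * Complex.I)) / h a)
        - Complex.log (-a) - Complex.log (1 - Complex.exp (Real.log s + θ * Complex.I) / a))
      (hlinec hs1 hsR hΓc).continuousOn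
      (Continuous.continuousOn (by
        have c1 := hlinec hs1 hsR (hexpc hcont)
        have c2 : Continuous fun θ : ℝ =>
            Complex.log (1 - h (Complex.exp (Real.log s + θ * Complex.I)) / h a) :=
          (continuous_const.sub (c1.div_const _)).clog fun θ => one_sub_mem_slitPlane (u1 θ)
        have c3 : Continuous fun θ : ℝ =>
            Complex.log (1 - Complex.exp (Real.log s + θ * Complex.I) / a) :=
          (by fun_prop : Continuous fun θ : ℝ =>
            1 - Complex.exp (Real.log s + θ * Complex.I) / a).clog
            fun θ => one_sub_mem_slitPlane (u2 θ)
        exact ((continuous_const.add c2).sub continuous_const).sub c3))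
      (fun θ _ => by
        have n1 := Complex.slitPlane_ne_zero (one_sub_mem_slitPlane (u1 θ))
        have n2 := Complex.slitPlane_ne_zero (one_sub_mem_slitPlane (u2 θ))
        have := hg (Complex.exp (Real.log s + θ * Complex.I)) (hin _ (by rw [(hl θ).2]; exact hsx))
        rw [hΓ _ (hl θ).1, Complex.exp_sub, Complex.exp_sub,
          Complex.exp_add (Complex.log (-h a)),
          Complex.exp_log (neg_ne_zero.2 hw0'), Complex.exp_log n1,
          Complex.exp_log (neg_ne_zero.2 ha0), Complex.exp_log n2]
        rw [eq_div_iff n2, eq_div_iff (neg_ne_zero.2 ha0)]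
        field_simp
        linear_combination -this)
      (mem_univ (2 * Real.pi)) (mem_univ 0)
    simp only [hper] at key
    have e := hk _ (hl 0).1
    rw [← e, show (Real.log s : ℂ) + (0 : ℝ) * Complex.I + (2 * Real.pi : ℝ) * Complex.I
      = Real.log s + (2 * Real.pi : ℝ) * Complex.I by push_cast; ring]
    linear_combination key
  -- comparison of the winding numbers on a circle near the outer boundary
  have hm1 : m = k + 2 * Real.pi * Complex.I := by
    have hxε : x + ε < R := by
      have h1 : a + ε ∈ Metric.closedBall a ε := by
        rw [mem_closedBall_iff_norm]; simp [abs_of_pos hε]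
      have h2 := (hεA h1).2
      have h3 : a + ε = ((x + ε : ℝ) : ℂ) := by rw [ha]; push_cast; ring
      rwa [h3, Complex.norm_real, Real.norm_of_nonneg (by linarith)] at h2
    obtain ⟨s, hs1, hsx, hsR, hs⟩ := exists_circle_near_outer hR hcont hh hcl hw0
      (hmaps a haA).2 hxε
    have hl := hline hs1 hsR
    have u1 : ∀ θ : ℝ, ‖h a / h (Complex.exp (Real.log s + θ * Complex.I))‖ < 1 := fun θ => by
      have := hs _ (hl θ).2
      rw [norm_div, div_lt_one (by linarith)]
      exact this
    have u2 : ∀ θ : ℝ, ‖a / Complex.exp (Real.log s + θ * Complex.I)‖ < 1 := fun θ => by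
      rw [norm_div, (hl θ).2, hax, div_lt_one (by linarith)]
      linarith
    have key := sub_eq_sub_of_exp_eq (s := univ) isPreconnected_univ
      (α := fun θ : ℝ => Φ (Real.log s + θ * Complex.I))
      (β := fun θ : ℝ => Γ (Real.log s + θ * Complex.I) + (Real.log s + θ * Complex.I)
        + Complex.log (1 - a / Complex.exp (Real.log s + θ * Complex.I))
        - Complex.log (1 - h a / h (Complex.exp (Real.log s + θ * Complex.I))))
      (hlinec hs1 hsR hΦc).continuousOn
      (Continuous.continuousOn (by
        have c0 := hlinec hs1 hsR hΓc
        have c1 := hlinec hs1 hsR (hexpc hcont)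
        have n1 := fun θ : ℝ => hh0 _ (exp_mem_annulus hR (hl θ).1)
        have c2 : Continuous fun θ : ℝ =>
            Complex.log (1 - h a / h (Complex.exp (Real.log s + θ * Complex.I))) :=
          (continuous_const.sub (continuous_const.div c1 n1)).clog
            fun θ => one_sub_mem_slitPlane (u1 θ)
        have c3 : Continuous fun θ : ℝ =>
            Complex.log (1 - a / Complex.exp (Real.log s + θ * Complex.I)) :=
          (continuous_const.sub (continuous_const.div (by fun_prop)
            fun θ => Complex.exp_ne_zero _)).clog fun θ => one_sub_mem_slitPlane (u2 θ)
        exact ((c0.add (by fun_prop)).add c3).sub c2))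
      (fun θ _ => by
        have n1 := Complex.slitPlane_ne_zero (one_sub_mem_slitPlane (u1 θ))
        have n2 := Complex.slitPlane_ne_zero (one_sub_mem_slitPlane (u2 θ))
        have n3 := hh0 _ (exp_mem_annulus hR (hl θ).1)
        have n4 := Complex.exp_ne_zero (Real.log s + θ * Complex.I)
        have := hg (Complex.exp (Real.log s + θ * Complex.I)) (hout _ (by rw [(hl θ).2]; exact hsx))
        rw [hΦ _ (hl θ).1, Complex.exp_sub, Complex.exp_add (_ + _), Complex.exp_add (Γ _),
          Complex.exp_log n1, Complex.exp_log n2, hΓ _ (hl θ).1, eq_div_iff n1]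
        generalize Complex.exp (Real.log s + θ * Complex.I) = w at *
        field_simp
        linear_combination this)
      (mem_univ (2 * Real.pi)) (mem_univ 0)
    simp only [hper] at key
    have e := hk _ (hl 0).1
    have e' := hm _ (hl 0).1
    have e2 : (Real.log s : ℂ) + (0 : ℝ) * Complex.I + (2 * Real.pi : ℝ) * Complex.I
      = Real.log s + (2 * Real.pi : ℝ) * Complex.I := by push_cast; ring
    rw [e2] at e e'
    rw [← e, ← e']
    push_cast at key ⊢
    linear_combination key
  intro z hz
  rw [hm z hz, hm1, hk0, zero_add]

end NitscheAnnuli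
end

/-! ### Passage to logarithmic coordinates. -/

noncomputable section
namespace NitscheAnnuli

open MeasureTheory Set ComplexConjugate

open Real (sinh cosh sinh_sq cosh_sq)

section composition

open InnerProductSpace

/-- Locally `f` is the real part of a holomorphic function, which can be composed with `g`. -/
lemma harmonicAt_real_comp {f : ℂ → ℝ} {g : ℂ → ℂ} {z : ℂ} (hf : HarmonicAt f (g z))
    (hg : AnalyticAt ℂ g z) : HarmonicAt (f ∘ g) z := by
  obtain ⟨ε, hε, hball⟩ := Metric.isOpen_iff.1 (isOpen_setOfPred_harmonicAt f) (g z) hf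
  obtain ⟨Φ, hΦ, hΦf⟩ := HarmonicOnNhd.exists_analyticOnNhd_ball_re_eq fun y hy => hball hy
  have h1 : HarmonicAt (fun w => (Φ (g w)).re) z :=
    AnalyticAt.harmonicAt_re ((hΦ (g z) (Metric.mem_ball_self hε)).comp hg)
  refine (harmonicAt_congr_nhds ?_).1 h1
  filter_upwards [hg.continuousAt.preimage_mem_nhds (Metric.ball_mem_nhds _ hε)] with w hw
  exact hΦf hw

/-- Harmonicity is preserved under composition with a holomorphic function on the right. -/
lemma harmonicAt_complex_comp {f g : ℂ → ℂ} {z : ℂ} (hf : HarmonicAt f (g z))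
    (hg : AnalyticAt ℂ g z) : HarmonicAt (f ∘ g) z := by
  have h1 := (harmonicAt_real_comp (hf.comp_CLM Complex.reCLM) hg).comp_CLM Complex.ofRealCLM
  have h2 := (harmonicAt_real_comp (hf.comp_CLM Complex.imCLM) hg).comp_CLM
    (Complex.I • Complex.ofRealCLM)
  refine (harmonicAt_congr_nhds (.of_forall fun w => ?_)).1 (h1.add h2)
  simp [mul_comm Complex.I]

end composition

/-- The partial derivatives of a harmonic `2πi`-periodic function on a strip. -/
lemma stripHarmonic_of_harmonicOnNhd {T : ℝ} {H : ℂ → ℂ}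
    (hH : InnerProductSpace.HarmonicOnNhd H (strip 0 T))
    (hper : ∀ z, H (z + (2 * Real.pi : ℝ) * Complex.I) = H z) :
    StripHarmonic T (fun t θ => H (t + θ * Complex.I))
      (fun t θ => fderiv ℝ H (t + θ * Complex.I) 1)
      (fun t θ => fderiv ℝ H (t + θ * Complex.I) Complex.I)
      (fun t θ => fderiv ℝ (fderiv ℝ H) (t + θ * Complex.I) 1 1) := by
  have hmem : ∀ {t : ℝ}, t ∈ Ioo 0 T → ∀ θ : ℝ, (t : ℂ) + θ * Complex.I ∈ strip 0 T :=
    fun ht θ => add_mem_strip (by simpa [strip] using ht) θ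
  have hjoint : ∀ {E : Type} [TopologicalSpace E] {f : ℂ → E}, ContinuousOn f (strip 0 T) →
      ContinuousOn (Function.uncurry fun (t θ : ℝ) => f (t + θ * Complex.I)) (Ioo 0 T ×ˢ univ) := by
    intro E _ f hf
    refine hf.comp (f := fun x : ℝ × ℝ => (x.1 : ℂ) + x.2 * Complex.I) (by fun_prop) ?_
    rintro ⟨t, θ⟩ ⟨ht, -⟩
    exact hmem ht θ
  have c1 : ∀ z ∈ strip 0 T, ContDiffAt ℝ 1 (fderiv ℝ H) z := fun z hz =>
    (hH z hz).1.fderiv_right (by norm_num)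
  have c2 : ∀ z ∈ strip 0 T, ContDiffAt ℝ 0 (fderiv ℝ (fderiv ℝ H)) z := fun z hz =>
    (c1 z hz).fderiv_right (by norm_num)
  have d0 : ∀ z ∈ strip 0 T, HasFDerivAt H (fderiv ℝ H z) z := fun z hz =>
    ((hH z hz).1.differentiableAt (by norm_num)).hasFDerivAt
  have d1 : ∀ z ∈ strip 0 T, HasFDerivAt (fderiv ℝ H) (fderiv ℝ (fderiv ℝ H) z) z := fun z hz =>
    ((c1 z hz).differentiableAt (by norm_num)).hasFDerivAt
  have d2 : ∀ v : ℂ, ∀ z ∈ strip 0 T, HasFDerivAt (fun w => fderiv ℝ H w v)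
      ((ContinuousLinearMap.apply ℝ ℂ v).comp (fderiv ℝ (fderiv ℝ H) z)) z := fun v z hz =>
    (ContinuousLinearMap.apply ℝ ℂ v).hasFDerivAt.comp z (d1 z hz)
  have cont1 : ContinuousOn (fderiv ℝ H) (strip 0 T) := fun z hz =>
    (c1 z hz).continuousAt.continuousWithinAt
  have cont2 : ContinuousOn (fderiv ℝ (fderiv ℝ H)) (strip 0 T) := fun z hz =>
    (c2 z hz).continuousAt.continuousWithinAt
  have lineT : ∀ t θ : ℝ, HasDerivAt (fun s : ℝ => (s : ℂ) + θ * Complex.I) 1 t := fun t θ =>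
    (Complex.ofRealCLM.hasDerivAt (x := t)).add_const _
  have lineθ : ∀ t θ : ℝ, HasDerivAt (fun s : ℝ => (t : ℂ) + s * Complex.I) Complex.I θ :=
    fun t θ => by
      simpa using ((Complex.ofRealCLM.hasDerivAt (x := θ)).mul_const Complex.I).const_add (t : ℂ)
  have hlap : ∀ z ∈ strip 0 T, fderiv ℝ (fderiv ℝ H) z Complex.I Complex.I
      = -fderiv ℝ (fderiv ℝ H) z 1 1 := fun z hz => by
    have := (hH z hz).2.self_of_nhds
    rw [InnerProductSpace.laplacian_eq_iteratedFDeriv_complexPlane] at this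
    simp only [iteratedFDeriv_two_apply, Pi.zero_apply] at this
    exact eq_neg_of_add_eq_zero_right this
  have hfper : ∀ z, fderiv ℝ H (z + (2 * Real.pi : ℝ) * Complex.I) = fderiv ℝ H z := fun z => by
    rw [← fderiv_comp_add_right]
    congr 1
    exact funext hper
  refine ⟨hjoint hH.continuousOn, hjoint (cont1.clm_apply continuousOn_const),
    hjoint (cont1.clm_apply continuousOn_const),
    hjoint ((cont2.clm_apply continuousOn_const).clm_apply continuousOn_const), ?_, ?_, ?_, ?_, ?_, ?_⟩
  · exact fun t ht θ => (d0 _ (hmem ht θ)).comp_hasDerivAt t (lineT t θ)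
  · intro t ht θ
    have := (d2 1 _ (hmem ht θ)).comp_hasDerivAt t (lineT t θ)
    exact this
  · exact fun t ht θ => (d0 _ (hmem ht θ)).comp_hasDerivAt θ (lineθ t θ)
  · intro t ht θ
    rw [← hlap _ (hmem ht θ)]
    exact (d2 Complex.I _ (hmem ht θ)).comp_hasDerivAt θ (lineθ t θ)
  · intro t ht
    simpa using hper t
  · intro t ht
    simp only [hfper]
    simp

/-- The logarithm `φ` is only continuous. It is compared with the primitive of `f' / f` starting at
`φ 0`, another logarithm of `f`, which must have the same increment. -/
lemma mean_im_div_eq_one {f f' φ : ℝ → ℂ} (hf : ∀ θ, HasDerivAt f (f' θ) θ) (hf' : Continuous f')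
    (hφ : Continuous φ) (hexp : ∀ θ, Complex.exp (φ θ) = f θ)
    (hinc : φ (2 * Real.pi) - φ 0 = 2 * Real.pi * Complex.I) :
    mean (fun θ => (f' θ / f θ).im) = 1 := by
  have hf0 : ∀ θ, f θ ≠ 0 := fun θ => hexp θ ▸ Complex.exp_ne_zero _
  have hfc : Continuous f := continuous_iff_continuousAt.2 fun θ => (hf θ).continuousAt
  have hq : Continuous fun θ => f' θ / f θ := hf'.div hfc hf0
  set β : ℝ → ℂ := fun θ => φ 0 + ∫ x in (0 : ℝ)..θ, f' x / f x with hβ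
  have dβ : ∀ θ, HasDerivAt β (f' θ / f θ) θ := fun θ =>
    (intervalIntegral.integral_hasDerivAt_right (hq.intervalIntegrable _ _)
      hq.aestronglyMeasurable.stronglyMeasurableAtFilter hq.continuousAt).const_add _
  have hβc : Continuous β := continuous_iff_continuousAt.2 fun θ => (dβ θ).continuousAt
  have dconst : ∀ θ, HasDerivAt (fun θ => Complex.exp (β θ) / f θ) 0 θ := fun θ => by
    refine ((dβ θ).cexp.div (hf θ) (hf0 θ)).congr_deriv ?_
    have := hf0 θ
    field_simp
    ring
  have hβexp : ∀ θ, Complex.exp (φ θ) = Complex.exp (β θ) := fun θ => by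
    have := is_const_of_deriv_eq_zero (fun θ => (dconst θ).differentiableAt)
      (fun θ => (dconst θ).deriv) θ 0
    have e0 : β 0 = φ 0 := by simp [hβ]
    rw [e0, hexp 0, div_self (hf0 0), div_eq_one_iff_eq (hf0 θ)] at this
    rw [this, hexp]
  have key := sub_eq_sub_of_exp_eq isPreconnected_univ hφ.continuousOn hβc.continuousOn
    (fun θ _ => hβexp θ) (mem_univ (2 * Real.pi)) (mem_univ 0)
  have e0 : β 0 = φ 0 := by simp [hβ]
  have e1 : ∫ x in (0 : ℝ)..2 * Real.pi, f' x / f x = 2 * Real.pi * Complex.I := by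
    have : β (2 * Real.pi) = φ 0 + ∫ x in (0 : ℝ)..2 * Real.pi, f' x / f x := rfl
    linear_combination hinc - key - this + e0
  unfold mean
  have e2 := Complex.imCLM.intervalIntegral_comp_comm (hq.intervalIntegrable (μ := volume) 0 (2 * Real.pi))
  simp only [Complex.imCLM_apply] at e2
  rw [e2, e1]
  have := Real.pi_pos
  simp
  field_simp

/-! ### Rigidity in the three classes of homeomorphisms. -/

section main

variable {h : ℂ → ℂ} {R Rs : ℝ}

/-- The logarithmic lift of `h`. -/
def lift (h : ℂ → ℂ) (t θ : ℝ) : ℂ := h (Complex.exp (t + θ * Complex.I))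

/-- The derivative of the logarithmic lift of `h` in the direction of `t`. -/
def liftDeriv (h : ℂ → ℂ) (t θ : ℝ) : ℂ :=
  fderiv ℝ (fun z => h (Complex.exp z)) (t + θ * Complex.I) 1

lemma exp_eq_circleMap (t θ : ℝ) :
    Complex.exp (t + θ * Complex.I) = circleMap 0 (Real.exp t) θ := by
  simp [circleMap, Complex.exp_add]

lemma coeff_lift_zero (h : ℂ → ℂ) (t : ℝ) :
    coeff (lift h t) 0 = Real.circleAverage h 0 (Real.exp t) := by
  simp [coeff, mean, lift, Real.circleAverage_def, exp_eq_circleMap]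

lemma cosh_log_eq (hR : 1 < R) : cosh (Real.log R) = (1 / 2) * (R + 1 / R) := by
  rw [Real.cosh_log (by linarith)]
  ring

/-- Chain rule: `∂/∂t = ρ ∂/∂ρ` for `ρ = exp t`. -/
lemma liftDeriv_eq {t θ : ℝ} (hd : DifferentiableAt ℝ h (Complex.exp (t + θ * Complex.I))) :
    liftDeriv h t θ = Real.exp t * normalDeriv h (Complex.exp (t + θ * Complex.I)) := by
  have h1 : HasFDerivAt (fun z => h (Complex.exp z)) _ ((t : ℂ) + θ * Complex.I) :=
    hd.hasFDerivAt.comp _ ((Complex.hasDerivAt_exp _).hasFDerivAt.restrictScalars ℝ)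
  have hn : ‖Complex.exp (t + θ * Complex.I)‖ = Real.exp t := by simp [Complex.norm_exp]
  rw [liftDeriv, h1.fderiv, normalDeriv, hn]
  have : Complex.exp (t + θ * Complex.I)
      = Real.exp t • (Complex.exp (t + θ * Complex.I) / (Real.exp t : ℂ)) := by
    have : (Real.exp t : ℂ) ≠ 0 := by exact_mod_cast (Real.exp_pos t).ne'
    rw [Complex.real_smul]
    field_simp
  simp only [ContinuousLinearMap.comp_apply, ContinuousLinearMap.coe_restrictScalars']
  rw [show (ContinuousLinearMap.toSpanSingleton ℂ (Complex.exp (t + θ * Complex.I))) (1 : ℂ)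
    = Complex.exp (t + θ * Complex.I) by simp]
  nth_rw 2 [this]
  rw [map_smul, Complex.real_smul]

lemma contDiffAt_of_mem (hh : h ∈ harmonicHomeos 1 R 1 Rs) {z : ℂ} (hz : z ∈ annulus 1 R) :
    ContDiffAt ℝ 2 h z := (hh.1 z hz).1

lemma stripHarmonic_lift (hR : 1 < R) (hh : h ∈ harmonicHomeos 1 R 1 Rs) :
    StripHarmonic (Real.log R) (lift h) (liftDeriv h)
      (fun t θ => fderiv ℝ (fun z => h (Complex.exp z)) (t + θ * Complex.I) Complex.I)
      (fun t θ => fderiv ℝ (fderiv ℝ fun z => h (Complex.exp z)) (t + θ * Complex.I) 1 1) :=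
  stripHarmonic_of_harmonicOnNhd
    (fun _ hz => harmonicAt_complex_comp (hh.1 _ (exp_mem_annulus hR hz))
      (Complex.differentiable_exp.analyticAt _))
    fun z => congrArg h (exp_add_two_pi_mul_I z)

lemma line_mem_strip {T t : ℝ} (ht : t ∈ Ioo 0 T) (θ : ℝ) :
    (t : ℂ) + θ * Complex.I ∈ strip 0 T :=
  add_mem_strip (by simpa [strip] using ht) θ

/-- A harmonic homeomorphism whose zeroth Fourier mode has nonnegative excess is a rotation of the
critical Nitsche map. -/
theorem mem_nitscheRotations_of_zeroMode (hR : 1 < R)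
    (hh : h ∈ harmonicHomeos 1 R 1 (cosh (Real.log R)))
    {κ : ℝ → ℝ} (hκc : Continuous κ) (hκ0 : ∀ t, 0 ≤ t → 0 ≤ κ t)
    (hadm : ∀ᶠ t in 𝓝[>] (0 : ℝ), Admissible (κ (Real.log R - t)) (Real.log R - t))
    (hadmT : Admissible (κ (Real.log R)) (Real.log R))
    (hzero : ∀ᶠ t in 𝓝[>] (0 : ℝ), 0 ≤ modeExcess (κ (Real.log R - t)) (Real.log R - t) 0
      (coeff (lift h t) 0) (coeff (liftDeriv h t) 0)) :
    h ∈ nitscheRotations R := by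
  have hT : 0 < Real.log R := Real.log_pos hR
  have hS := stripHarmonic_lift hR hh
  obtain ⟨hharm, hhomeo, hor, hcl⟩ := hh
  have hcont : ContinuousOn h (annulus 1 R) := hharm.continuousOn
  have hmaps : ∀ z ∈ annulus 1 R, h z ∈ annulus 1 (cosh (Real.log R)) :=
    fun z hz => mem_annulus_of_isHomeoOn hhomeo hz
  have hA : ∀ t ∈ Ioo 0 (Real.log R), ∀ θ : ℝ, Complex.exp (t + θ * Complex.I) ∈ annulus 1 R :=
    fun t ht θ => exp_mem_annulus hR (line_mem_strip ht θ)
  have hlim : ∀ δ > 0, ∀ᶠ t in 𝓝[>] (0 : ℝ), ∀ θ, ‖lift h t θ‖ ^ 2 ≤ 1 + δ := by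
    intro δ hδ
    obtain ⟨ρ, hρ, hin⟩ := exists_norm_lt_near_inner hmaps hcl
      (show 1 < √(1 + δ) from Real.lt_sqrt_of_sq_lt (by linarith))
    filter_upwards [Ioo_mem_nhdsGT hT, Ioo_mem_nhdsGT (Real.log_pos hρ)] with t ht htρ θ
    have := hin _ (hA t ht θ) (by
      simpa [Complex.norm_exp] using (Real.lt_log_iff_exp_lt (by linarith)).1 htρ.2)
    rw [lift, ← Real.sq_sqrt (show 0 ≤ 1 + δ by linarith)]
    gcongr
  obtain ⟨Φ, hΦc, hΦ, hΦi⟩ := exists_log_comp_exp hR hcont hhomeo hor hcl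
  obtain ⟨α, hα⟩ := hS.exists_eq_cosh_mul_exp hT (fun t ht θ => (hmaps _ (hA t ht θ)).1)
    (fun t ht θ => (hmaps _ (hA t ht θ)).2) hlim
    (fun t ht => mean_im_div_eq_one (hS.derivF' t ht) (continuous_slice hS.contQ ht)
      (φ := fun θ => Φ (t + θ * Complex.I))
      (hΦc.comp_continuous (by fun_prop) (line_mem_strip ht)) (fun θ => hΦ _ (line_mem_strip ht θ))
      (by
        have := hΦi _ (line_mem_strip ht 0)
        simpa using this)) hκc hκ0 hadm hadmT hzero
  have hnorm : ∀ t ∈ Ioo 0 (Real.log R), ‖lift h t 0‖ = ‖α‖ * cosh t := fun t ht => by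
    rw [hα t ht 0 ⟨le_rfl, Real.two_pi_pos.le⟩, norm_mul, norm_mul, Complex.norm_real,
      Real.norm_of_nonneg (Real.cosh_pos t).le]
    simp
  have hcosh : Tendsto (fun t => ‖α‖ * cosh t) (𝓝[>] 0) (𝓝 ‖α‖) :=
    (Continuous.tendsto' (by fun_prop) _ _ (by simp)).mono_left nhdsWithin_le_nhds
  have hge : 1 ≤ ‖α‖ := by
    refine ge_of_tendsto hcosh ?_
    filter_upwards [Ioo_mem_nhdsGT hT] with t ht
    rw [← hnorm t ht]
    exact (hmaps _ (hA t ht 0)).1.le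
  have hle : ‖α‖ ^ 2 ≤ 1 := by
    refine le_of_forall_pos_le_add fun δ hδ => ?_
    refine le_of_tendsto (hcosh.pow 2) ?_
    filter_upwards [Ioo_mem_nhdsGT hT, hlim δ hδ] with t ht hb
    rw [← hnorm t ht]
    exact hb 0
  refine ⟨α, by nlinarith, fun z hz => ?_⟩
  have hz0 : 0 < ‖z‖ := lt_trans one_pos hz.1
  have hzs : z ∈ Metric.sphere (0 : ℂ) |‖z‖| := by simp
  rw [← image_circleMap_Ioc] at hzs
  obtain ⟨θ, hθ, hzθ⟩ := hzs
  have ht : Real.log ‖z‖ ∈ Ioo 0 (Real.log R) :=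
    ⟨Real.log_pos hz.1, Real.log_lt_log hz0 hz.2⟩
  have key := hα _ ht θ (Ioc_subset_Icc_self hθ)
  have e1 : Complex.exp (Real.log ‖z‖ + θ * Complex.I) = z := by
    rw [exp_eq_circleMap, Real.exp_log hz0, hzθ]
  rw [lift, e1] at key
  rw [key]
  simp only [nitscheMap]
  have e2 : z = ‖z‖ * Complex.exp (θ * Complex.I) := by
    conv_lhs => rw [← hzθ]
    simp [circleMap]
  have e3 : (starRingEnd ℂ) (Complex.exp (θ * Complex.I)) = (Complex.exp (θ * Complex.I))⁻¹ := by
    rw [← Complex.exp_conj, ← Complex.exp_neg]; simp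
  rw [Real.cosh_log hz0]
  generalize ‖z‖ = r at *
  rw [e2, map_mul, Complex.conj_ofReal, e3]
  have : Complex.exp (θ * Complex.I) ≠ 0 := Complex.exp_ne_zero _
  have hr : (r : ℂ) ≠ 0 := by exact_mod_cast hz0.ne'
  push_cast
  field_simp

lemma eventually_sub_mem {T : ℝ} (hT : 0 < T) : ∀ᶠ t in 𝓝[>] (0 : ℝ), t ∈ Ioo 0 T ∧ 0 < T - t := by
  filter_upwards [Ioo_mem_nhdsGT hT] with t ht
  exact ⟨ht, sub_pos.2 ht.2⟩

lemma tendsto_exp_nhdsGT : Tendsto Real.exp (𝓝[>] 0) (𝓝[>] 1) := by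
  refine tendsto_nhdsWithin_iff.2 ⟨?_, ?_⟩
  · exact (Real.continuous_exp.tendsto' 0 1 Real.exp_zero).mono_left nhdsWithin_le_nhds
  · filter_upwards [self_mem_nhdsWithin] with t ht
    exact Real.one_lt_exp_iff.2 ht

/-- The weight `2 sinh²` works for every annulus. -/
lemma mem_nitscheRotations_of_zeroMode' (hR : 1 < R)
    (hh : h ∈ harmonicHomeos 1 R 1 (cosh (Real.log R)))
    (hzero : ∀ᶠ t in 𝓝[>] (0 : ℝ),
      0 ≤ modeExcess (2 * sinh (Real.log R - t) ^ 2) (Real.log R - t) 0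
        (coeff (lift h t) 0) (coeff (liftDeriv h t) 0)) :
    h ∈ nitscheRotations R :=
  mem_nitscheRotations_of_zeroMode hR hh (κ := fun t => 2 * sinh t ^ 2) (by fun_prop)
    (fun t _ => by positivity)
    ((eventually_sub_mem (Real.log_pos hR)).mono fun _ ht => admissible_two_mul_sinh_sq ht.2)
    (admissible_two_mul_sinh_sq (Real.log_pos hR)) hzero

/-- The zeroth mode is `p + q t`, and the vanishing boundary average means `p = 0`. Its excess is
then `(T² + o(1)) |q|²` as `t → 0`, where `T = log R`. -/
theorem mem_nitscheRotations_of_mem_harmonicHomeosD (hR : 1 < R)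
    (hh : h ∈ harmonicHomeosD 1 R 1 (cosh (Real.log R))) : h ∈ nitscheRotations R := by
  obtain ⟨hh, hD⟩ := hh
  have hT : 0 < Real.log R := Real.log_pos hR
  have hS := stripHarmonic_lift hR hh
  obtain ⟨p, q, hpq⟩ := hS.exists_coeff_eq hT
  have hI : ∀ᶠ t in 𝓝[>] (0 : ℝ), t ∈ Ioo 0 (Real.log R) := Ioo_mem_nhdsGT hT
  have hp : p 0 = 0 := by
    have h1 : Tendsto (fun t => coeff (lift h t) 0) (𝓝[>] 0) (𝓝 0) := by
      simp only [coeff_lift_zero]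
      exact hD.comp tendsto_exp_nhdsGT
    have h2 : Tendsto (fun t : ℝ => p 0 + q 0 * t) (𝓝[>] 0) (𝓝 (p 0)) :=
      (Continuous.tendsto' (by fun_prop) _ _ (by simp)).mono_left nhdsWithin_le_nhds
    refine tendsto_nhds_unique h2 (h1.congr' (hI.mono fun t ht => ?_))
    rw [(hpq 0 t ht).1]
    simp [sinhDiv]
  refine mem_nitscheRotations_of_zeroMode' hR hh ?_
  have hb : Tendsto (fun t : ℝ => Real.log R ^ 2
      - 2 * (sinh (Real.log R - t) * cosh (Real.log R - t)) * t
      - (cosh (Real.log R - t) ^ 2 - 2 * sinh (Real.log R - t) ^ 2) * t ^ 2) (𝓝[>] 0)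
      (𝓝 (Real.log R ^ 2)) :=
    (Continuous.tendsto' (by fun_prop) _ _ (by simp)).mono_left nhdsWithin_le_nhds
  filter_upwards [hI, hb.eventually_const_lt (u := 0) (by positivity)] with t ht hpos
  rw [(hpq 0 t ht).1, (hpq 0 t ht).2, hp]
  have e : modeExcess (2 * sinh (Real.log R - t) ^ 2) (Real.log R - t) 0
      (0 * (cosh ((0 : ℤ) * t) : ℂ) + q 0 * sinhDiv 0 t)
      (0 * (((0 : ℤ) : ℂ) ^ 2 * sinhDiv 0 t) + q 0 * cosh ((0 : ℤ) * t))
      = (Real.log R ^ 2 - 2 * (sinh (Real.log R - t) * cosh (Real.log R - t)) * t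
        - (cosh (Real.log R - t) ^ 2 - 2 * sinh (Real.log R - t) ^ 2) * t ^ 2) * ‖q 0‖ ^ 2 := by
    rw [modeExcess_eq]
    simp only [sinhDiv, if_true, Int.cast_zero, zero_mul, zero_add, Real.cosh_zero,
      Complex.ofReal_one, mul_one, norm_mul, Complex.norm_real, Real.norm_of_nonneg ht.1.le,
      map_mul, Complex.conj_ofReal, ← mul_assoc, Complex.mul_conj, ← Complex.normSq_eq_norm_sq,
      ← Complex.ofReal_mul, Complex.ofReal_re, mul_pow]
    ring
  rw [e]
  positivity

/-- The zeroth mode `p + q t` has constant derivative, so a single radius gives `q = 0`. Its excess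
for the weight `2 sinh² τ` is then `sinh² τ |c_0|²`. -/
theorem mem_nitscheRotations_of_mem_harmonicHomeosN (hR : 1 < R)
    (hh : h ∈ harmonicHomeosN 1 R 1 (cosh (Real.log R))) : h ∈ nitscheRotations R := by
  obtain ⟨hh, ρ, hρ1, hρR, hN⟩ := hh
  have hT : 0 < Real.log R := Real.log_pos hR
  have hS := stripHarmonic_lift hR hh
  obtain ⟨p, q, hpq⟩ := hS.exists_coeff_eq hT
  have hρ : Real.log ρ ∈ Ioo 0 (Real.log R) :=
    ⟨Real.log_pos hρ1, Real.log_lt_log (by linarith) hρR⟩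
  have hP : coeff (liftDeriv h (Real.log ρ)) 0 = 0 := by
    have e : liftDeriv h (Real.log ρ) = fun θ : ℝ => (ρ : ℂ) * normalDeriv h (circleMap 0 ρ θ) := by
      ext θ
      rw [liftDeriv_eq ((contDiffAt_of_mem hh (exp_mem_annulus hR
        (line_mem_strip hρ θ))).differentiableAt (by norm_num)), exp_eq_circleMap,
        Real.exp_log (by linarith)]
    rw [e, coeff_const_mul]
    have : coeff (fun θ : ℝ => normalDeriv h (circleMap 0 ρ θ)) 0
        = Real.circleAverage (normalDeriv h) 0 ρ := by
      simp [coeff, mean, Real.circleAverage_def]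
    rw [this, hN, mul_zero]
  have hq : q 0 = 0 := by
    rw [(hpq 0 _ hρ).2] at hP
    simpa using hP
  refine mem_nitscheRotations_of_zeroMode' hR hh ?_
  filter_upwards [Ioo_mem_nhdsGT hT] with t ht
  have e : coeff (liftDeriv h t) 0 = 0 := by rw [(hpq 0 t ht).2, hq]; simp
  rw [e, modeExcess_eq]
  have hcs := cosh_sq (Real.log R - t)
  have : 0 ≤ (sinh (Real.log R - t) ^ 2) * ‖coeff (lift h t) 0‖ ^ 2 := by positivity
  simp
  rw [hcs]
  linarith

/-- The weight is `2 sinh² τ` if `log R ≤ 1` and `2 sinh τ cosh τ` otherwise. In the second case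
only `τ` near `log R` matters, so `τ > 1` may be assumed. -/
theorem mem_nitscheRotations_of_log_le (hR : 1 < R) (hR2 : Real.log R ≤ 3 / 2)
    (hh : h ∈ harmonicHomeos 1 R 1 (cosh (Real.log R))) : h ∈ nitscheRotations R := by
  have hT : 0 < Real.log R := Real.log_pos hR
  rcases le_or_gt (Real.log R) 1 with hR1 | hR1
  · refine mem_nitscheRotations_of_zeroMode' hR hh ?_
    filter_upwards [eventually_sub_mem hT] with t ht
    refine modeExcess_nonneg ht.2.ne' ?_ _ _
    have := zero_mode_of_le_one ht.2 (by linarith [ht.1.1])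
    have hcs := cosh_sq (Real.log R - t)
    simp [sinhDiv]
    rw [hcs]
    nlinarith
  · have hev : ∀ᶠ t in 𝓝[>] (0 : ℝ), 0 < t ∧ 1 < Real.log R - t := by
      filter_upwards [Ioo_mem_nhdsGT (show 0 < Real.log R - 1 by linarith)] with t ht
      exact ⟨ht.1, by linarith [ht.2]⟩
    refine mem_nitscheRotations_of_zeroMode hR hh (κ := fun t => 2 * (sinh t * cosh t))
      (by fun_prop) (fun t ht => ?_) (hev.mono fun t ht => admissible_sinh_two_mul ht.2.le)
      (admissible_sinh_two_mul hR1.le) ?_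
    · have := Real.sinh_nonneg_iff.2 ht
      have := Real.cosh_pos t
      positivity
    · filter_upwards [hev] with t ht
      refine modeExcess_nonneg (by linarith) ?_ _ _
      have := zero_mode_of_mem_Icc (τ := Real.log R - t) ⟨ht.2.le, by linarith⟩
      have hcs := cosh_sq (Real.log R - t)
      simp [sinhDiv]
      rw [hcs]
      nlinarith

end main

end NitscheAnnuli
end

/-! ### Rotations of the critical Nitsche map belong to all three classes. -/

noncomputable section
namespace NitscheAnnuli

open MeasureTheory Set ComplexConjugate

section nitsche

/-- The radial profile of the critical Nitsche map. -/
def nitscheRadius (r : ℝ) : ℝ := (1 / 2) * (r + 1 / r)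

lemma nitscheMap_mul_ofReal {u : ℂ} (hu : ‖u‖ = 1) {r : ℝ} (hr : r ≠ 0) :
    nitscheMap (u * r) = u * nitscheRadius r := by
  have hu0 : u ≠ 0 := norm_pos_iff.1 (by rw [hu]; exact one_pos)
  have hr' : (r : ℂ) ≠ 0 := by exact_mod_cast hr
  have h1 : (starRingEnd ℂ) u = u⁻¹ := by
    rw [Complex.inv_def, Complex.normSq_eq_norm_sq, hu]
    simp
  rw [nitscheMap, map_mul, h1, Complex.conj_ofReal, nitscheRadius]
  push_cast
  field_simp

lemma norm_div_norm {z : ℂ} (hz : z ≠ 0) : ‖z / (‖z‖ : ℂ)‖ = 1 := by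
  have : ‖z‖ ≠ 0 := norm_ne_zero_iff.2 hz
  simp [this]

lemma nitscheMap_eq {z : ℂ} (hz : z ≠ 0) :
    nitscheMap z = z / ‖z‖ * nitscheRadius ‖z‖ := by
  have h0 : ‖z‖ ≠ 0 := norm_ne_zero_iff.2 hz
  have h1 : (‖z‖ : ℂ) ≠ 0 := by exact_mod_cast h0
  rw [← nitscheMap_mul_ofReal (norm_div_norm hz) h0, div_mul_cancel₀ _ h1]

lemma one_le_nitscheRadius {r : ℝ} (hr : 0 < r) : 1 ≤ nitscheRadius r := by
  have : nitscheRadius r - 1 = (r - 1) ^ 2 / (2 * r) := by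
    unfold nitscheRadius; field_simp; ring
  have h2 : 0 ≤ (r - 1) ^ 2 / (2 * r) := by positivity
  linarith

lemma nitscheRadius_mem {R r : ℝ} (h1 : 1 < r) (h2 : r < R) :
    1 < nitscheRadius r ∧ nitscheRadius r < nitscheRadius R := by
  have hr : 0 < r := by linarith
  have hR : 0 < R := by linarith
  constructor
  · have : nitscheRadius r - 1 = (r - 1) ^ 2 / (2 * r) := by
      unfold nitscheRadius; field_simp; ring
    have h3 : 0 < r - 1 := by linarith
    have h4 : 0 < (r - 1) ^ 2 / (2 * r) := by positivity
    linarith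
  · have : nitscheRadius R - nitscheRadius r = (R - r) * (r * R - 1) / (2 * r * R) := by
      unfold nitscheRadius; field_simp; ring
    have h3 : 0 < R - r := by linarith
    have h4 : 0 < r * R - 1 := by nlinarith
    have h5 : 0 < (R - r) * (r * R - 1) / (2 * r * R) := by positivity
    linarith

lemma norm_mul_nitscheMap {α : ℂ} (hα : ‖α‖ = 1) {z : ℂ} (hz : z ≠ 0) :
    ‖α * nitscheMap z‖ = nitscheRadius ‖z‖ := by
  have := one_le_nitscheRadius (norm_pos_iff.2 hz)
  rw [norm_mul, hα, nitscheMap_eq hz, norm_mul, norm_div_norm hz, Complex.norm_real,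
    Real.norm_of_nonneg (by linarith)]
  ring

/-- The inverse of the radial profile of the critical Nitsche map. -/
def nitscheRadiusInv (s : ℝ) : ℝ := s + √(s ^ 2 - 1)

lemma nitscheRadiusInv_nitscheRadius {r : ℝ} (hr : 1 < r) :
    nitscheRadiusInv (nitscheRadius r) = r := by
  have h0 : 0 < r := by linarith
  have e : nitscheRadius r ^ 2 - 1 = ((r - 1 / r) / 2) ^ 2 := by
    unfold nitscheRadius; field_simp; ring
  have h1 : 0 ≤ (r - 1 / r) / 2 := by
    have : 1 / r ≤ 1 := by rw [div_le_one h0]; linarith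
    linarith
  rw [nitscheRadiusInv, e, Real.sqrt_sq h1, nitscheRadius]
  ring

lemma nitscheRadius_nitscheRadiusInv {s : ℝ} (hs : 1 < s) :
    nitscheRadius (nitscheRadiusInv s) = s := by
  have h1 : 0 ≤ s ^ 2 - 1 := by nlinarith
  have h2 := Real.sq_sqrt h1
  have h3 := Real.sqrt_nonneg (s ^ 2 - 1)
  unfold nitscheRadius nitscheRadiusInv
  have h4 : 0 < s + √(s ^ 2 - 1) := by linarith
  field_simp
  nlinarith

lemma nitscheRadiusInv_mem {R s : ℝ} (hR : 1 < R) (h1 : 1 < s) (h2 : s < nitscheRadius R) :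
    1 < nitscheRadiusInv s ∧ nitscheRadiusInv s < R := by
  have h3 := Real.sqrt_nonneg (s ^ 2 - 1)
  refine ⟨by unfold nitscheRadiusInv; linarith, ?_⟩
  by_contra! hcon
  have h4 := nitscheRadius_nitscheRadiusInv h1
  rcases hcon.eq_or_lt with h5 | h5
  · rw [← h5] at h4; linarith
  · have := (nitscheRadius_mem hR h5).2; linarith

lemma ne_zero_of_mem_annulus {R : ℝ} {z : ℂ} (hz : z ∈ annulus 1 R) : z ≠ 0 :=
  norm_pos_iff.1 (lt_trans one_pos hz.1)

lemma isHomeoOn_mul_nitscheMap {R : ℝ} (hR : 1 < R) {α : ℂ} (hα : ‖α‖ = 1) :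
    IsHomeoOn (fun z => α * nitscheMap z) (annulus 1 R) (annulus 1 (nitscheRadius R)) := by
  have hα0 : α ≠ 0 := norm_pos_iff.1 (by rw [hα]; exact one_pos)
  have hnorm : ∀ w ∈ annulus 1 (nitscheRadius R),
      ‖w / (α * ‖w‖) * nitscheRadiusInv ‖w‖‖ = nitscheRadiusInv ‖w‖ := fun w hw => by
    have h0 : 0 < ‖w‖ := lt_trans one_pos hw.1
    have h1 := (nitscheRadiusInv_mem hR hw.1 hw.2).1
    rw [norm_mul, norm_div, norm_mul, hα, Complex.norm_real, Complex.norm_real, norm_norm,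
      Real.norm_of_nonneg (by linarith), one_mul, div_self h0.ne', one_mul]
  have hto : ∀ z : annulus 1 R, α * nitscheMap z ∈ annulus 1 (nitscheRadius R) := fun z => by
    have := nitscheRadius_mem z.2.1 z.2.2
    rw [annulus, mem_ofPred_eq, norm_mul_nitscheMap hα (ne_zero_of_mem_annulus z.2)]
    exact this
  have hinv : ∀ w : annulus 1 (nitscheRadius R),
      (w : ℂ) / (α * ‖(w : ℂ)‖) * nitscheRadiusInv ‖(w : ℂ)‖ ∈ annulus 1 R := fun w => by
    rw [annulus, mem_ofPred_eq, hnorm w w.2]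
    exact nitscheRadiusInv_mem hR w.2.1 w.2.2
  refine ⟨⟨⟨fun z => ⟨α * nitscheMap z, hto z⟩, fun w => ⟨_, hinv w⟩, ?_, ?_⟩, ?_, ?_⟩,
    fun z => rfl⟩
  · rintro ⟨z, hz⟩
    have hz0 := ne_zero_of_mem_annulus hz
    refine Subtype.ext ?_
    simp only
    rw [norm_mul_nitscheMap hα hz0, nitscheRadiusInv_nitscheRadius hz.1, nitscheMap_eq hz0]
    have h1 : (‖z‖ : ℂ) ≠ 0 := by exact_mod_cast norm_ne_zero_iff.2 hz0
    have h2 : (nitscheRadius ‖z‖ : ℂ) ≠ 0 := by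
      have := one_le_nitscheRadius (norm_pos_iff.2 hz0)
      exact_mod_cast (by linarith : 0 < nitscheRadius ‖z‖).ne'
    field_simp
  · rintro ⟨w, hw⟩
    refine Subtype.ext ?_
    simp only
    have h0 : w ≠ 0 := norm_pos_iff.1 (lt_trans one_pos hw.1)
    have hn0 : (‖w‖ : ℂ) ≠ 0 := by exact_mod_cast norm_ne_zero_iff.2 h0
    have hu : ‖w / (α * ‖w‖)‖ = 1 := by simp [hα, h0]
    have h1 := (nitscheRadiusInv_mem hR hw.1 hw.2).1
    rw [nitscheMap_mul_ofReal hu (by linarith), nitscheRadius_nitscheRadiusInv hw.1]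
    field_simp
  · refine Continuous.subtype_mk ?_ _
    unfold nitscheMap
    have h0 : ∀ z : annulus 1 R, (starRingEnd ℂ) (z : ℂ) ≠ 0 := fun z => by
      simpa using ne_zero_of_mem_annulus z.2
    have h1 : Continuous fun z : annulus 1 R => (starRingEnd ℂ) (z : ℂ) :=
      Complex.continuous_conj.comp continuous_subtype_val
    exact continuous_const.mul (continuous_const.mul
      (continuous_subtype_val.add (continuous_const.div h1 h0)))
  · refine Continuous.subtype_mk ?_ _
    have h0 : ∀ w : annulus 1 (nitscheRadius R), α * (‖(w : ℂ)‖ : ℂ) ≠ 0 := fun w => by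
      simpa [hα0] using ne_zero_of_mem_annulus w.2
    unfold nitscheRadiusInv
    exact (continuous_subtype_val.div (by fun_prop) h0).mul (by fun_prop)

lemma IsHomeoOn.congr {f g : ℂ → ℂ} {U V : Set ℂ} (h : IsHomeoOn f U V) (hfg : EqOn g f U) :
    IsHomeoOn g U V := by
  obtain ⟨e, he⟩ := h
  exact ⟨e, fun z => (he z).trans (hfg z.2).symm⟩

/-- The map is a holomorphic function plus the conjugate of a holomorphic function. -/
lemma harmonicAt_mul_nitscheMap (α : ℂ) {z : ℂ} (hz : z ≠ 0) :
    InnerProductSpace.HarmonicAt (fun z => α * nitscheMap z) z := by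
  have h1 : InnerProductSpace.HarmonicAt (fun z : ℂ => α * ((1 / 2) * z)) z :=
    AnalyticAt.harmonicAt (by fun_prop)
  have h2 : InnerProductSpace.HarmonicAt (fun z : ℂ => (starRingEnd ℂ) α * ((1 / 2) * (1 / z))) z :=
    AnalyticAt.harmonicAt (analyticAt_const.mul (analyticAt_const.mul
      (analyticAt_const.div analyticAt_id hz)))
  refine (InnerProductSpace.harmonicAt_congr_nhds (.of_forall fun w => ?_)).1
    (h1.add (h2.comp_CLM Complex.conjCLE.toContinuousLinearMap))
  have h2 : (starRingEnd ℂ) (2 : ℂ) = 2 := Complex.conj_ofNat 2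
  simp [nitscheMap, h2]
  ring

lemma preservesOrientationOn_mul_nitscheMap {R : ℝ} {α : ℂ} (hα : α ≠ 0) :
    PreservesOrientationOn (fun z => α * nitscheMap z) (annulus 1 R) := by
  intro a ε hε hsub
  have haA : a ∈ annulus 1 R := hsub (Metric.mem_closedBall_self hε.le)
  have hzA : ∀ θ, circleMap a ε θ ∈ annulus 1 R := fun θ =>
    hsub (Metric.sphere_subset_closedBall (circleMap_mem_sphere a hε.le θ))
  -- With `z = a + d` on the circle, `α (h¹ z - h¹ a) = (α / 2) d (1 - u)`, and `|u| < 1` because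
  -- `|z| |a| > 1`. The factor `d` makes one turn, while `log (1 - u)` is single valued.
  set u : ℝ → ℂ := fun θ => (starRingEnd ℂ) (circleMap 0 ε θ)
    / (circleMap 0 ε θ * (starRingEnd ℂ) (circleMap a ε θ * a)) with hu
  have hc0 : ∀ θ, circleMap 0 ε θ ≠ 0 := fun θ => circleMap_ne_center hε.ne'
  have hu1 : ∀ θ, ‖u θ‖ < 1 := fun θ => by
    have h1 : 0 < ‖circleMap 0 ε θ‖ := norm_pos_iff.2 (hc0 θ)
    have h2 : 1 < ‖circleMap a ε θ‖ * ‖a‖ := by nlinarith [(hzA θ).1, haA.1]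
    simp only [hu]
    rw [norm_div, norm_mul, RCLike.norm_conj, RCLike.norm_conj, norm_mul, div_lt_one (by positivity)]
    nlinarith
  have huc : Continuous u := by
    have h1 : ∀ θ, circleMap 0 ε θ * (starRingEnd ℂ) (circleMap a ε θ * a) ≠ 0 := fun θ =>
      mul_ne_zero (hc0 θ) (by
        simpa using ⟨ne_zero_of_mem_annulus (hzA θ), ne_zero_of_mem_annulus haA⟩)
    have h2 := continuous_circleMap 0 ε
    have h3 := continuous_circleMap a ε
    exact (Complex.continuous_conj.comp h2).div
      (h2.mul (Complex.continuous_conj.comp (h3.mul continuous_const))) h1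
  refine ⟨fun θ => θ * Complex.I + Complex.log (α * ε / 2) + Complex.log (1 - u θ), ?_, ?_, ?_⟩
  · have : Continuous fun θ => Complex.log (1 - u θ) :=
      (continuous_const.sub huc).clog fun θ => one_sub_mem_slitPlane (hu1 θ)
    exact (Continuous.add (by fun_prop) this).continuousOn
  · intro θ _
    have hε' : (ε : ℂ) ≠ 0 := by exact_mod_cast hε.ne'
    rw [Complex.exp_add, Complex.exp_add, Complex.exp_log (by simp [hα, hε']),
      Complex.exp_log (Complex.slitPlane_ne_zero (one_sub_mem_slitPlane (hu1 θ)))]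
    have e1 : circleMap a ε θ = a + circleMap 0 ε θ := by simp [circleMap]
    have e2 : circleMap 0 ε θ = ε * Complex.exp (θ * Complex.I) := by simp [circleMap]
    have e3 : Complex.exp (θ * Complex.I) = circleMap 0 ε θ / ε := by rw [e2]; field_simp
    have n1 := hc0 θ
    have n2 : (starRingEnd ℂ) a ≠ 0 := by simpa using ne_zero_of_mem_annulus haA
    have n3 : (starRingEnd ℂ) a + (starRingEnd ℂ) (circleMap 0 ε θ) ≠ 0 := by
      rw [← map_add, ← e1]
      simpa using ne_zero_of_mem_annulus (hzA θ)
    simp only [hu, nitscheMap]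
    rw [e3, e1, map_mul, map_add]
    generalize circleMap 0 ε θ = d at *
    generalize (starRingEnd ℂ) a = a' at *
    generalize (starRingEnd ℂ) d = d' at *
    field_simp
    ring
  · have : u (2 * Real.pi) = u 0 := by simp [hu, circleMap]
    simp only [this]
    push_cast
    ring

lemma PreservesOrientationOn.congr {f g : ℂ → ℂ} {U : Set ℂ} (h : PreservesOrientationOn f U)
    (hfg : EqOn g f U) : PreservesOrientationOn g U := by
  intro a ε hε hsub
  have e : (fun θ => g (circleMap a ε θ) - g a) = fun θ => f (circleMap a ε θ) - f a := by
    ext θ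
    rw [hfg (hsub (Metric.mem_closedBall_self hε.le)),
      hfg (hsub (Metric.sphere_subset_closedBall (circleMap_mem_sphere a hε.le θ)))]
  rw [e]
  exact h a ε hε hsub

lemma clusterSet_nitsche {R : ℝ} (hR : 1 < R) {α : ℂ} (hα : ‖α‖ = 1) {h : ℂ → ℂ}
    (hh : EqOn h (fun z => α * nitscheMap z) (annulus 1 R)) :
    clusterSet h (annulus 1 R) (Metric.sphere 0 1) = Metric.sphere 0 1 := by
  have hα0 : α ≠ 0 := norm_pos_iff.1 (by rw [hα]; exact one_pos)
  have hN : ∀ z : ℂ, z ≠ 0 → ContinuousAt (fun z => α * nitscheMap z) z := fun z hz =>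
    (harmonicAt_mul_nitscheMap α hz).1.continuousAt
  have h1N : nitscheRadius 1 = 1 := by norm_num [nitscheRadius]
  ext w
  rw [mem_sphere_zero_iff_norm]
  constructor
  · intro hw
    have hlim : Tendsto (fun z => ‖h z‖) (𝓝ˢ (Metric.sphere (0 : ℂ) 1) ⊓ 𝓟 (annulus 1 R)) (𝓝 1) := by
      have h1 : Tendsto (fun z => ‖α * nitscheMap z‖) (𝓝ˢ (Metric.sphere (0 : ℂ) 1)) (𝓝 1) := by
        intro U hU
        rw [mem_map, mem_nhdsSet_iff_forall]
        intro x hx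
        rw [mem_sphere_zero_iff_norm] at hx
        have hx0 : x ≠ 0 := norm_pos_iff.1 (by rw [hx]; exact one_pos)
        refine (hN x hx0).norm.preimage_mem_nhds ?_
        rwa [norm_mul_nitscheMap hα hx0, hx, h1N]
      refine (h1.mono_left inf_le_left).congr' ?_
      filter_upwards [mem_inf_of_right (mem_principal_self _)] with z hz
      rw [hh hz]
    have hw' : MapClusterPt w (𝓝ˢ (Metric.sphere (0 : ℂ) 1) ⊓ 𝓟 (annulus 1 R)) h := hw
    have h2 : MapClusterPt ‖w‖ _ (fun z => ‖h z‖) :=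
      MapClusterPt.continuousAt_comp continuous_norm.continuousAt hw'
    have h3 : ClusterPt ‖w‖ (𝓝 1) := ClusterPt.mono h2 hlim
    exact eq_of_nhds_neBot h3
  · intro hw
    have hu : ‖w / α‖ = 1 := by rw [norm_div, hw, hα, div_one]
    have hu0 : w / α ≠ 0 := norm_pos_iff.1 (by rw [hu]; exact one_pos)
    have hmem : ∀ᶠ t : ℝ in 𝓝[>] (1 : ℝ), w / α * (t : ℂ) ∈ annulus 1 R := by
      filter_upwards [Ioo_mem_nhdsGT hR] with t ht
      rw [annulus, mem_ofPred_eq, norm_mul, hu, one_mul, Complex.norm_real,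
        Real.norm_of_nonneg (by linarith [ht.1])]
      exact ht
    have ht : Tendsto (fun t : ℝ => w / α * t) (𝓝[>] 1) (𝓝 (w / α)) :=
      (Continuous.tendsto' (by fun_prop) _ _ (by simp)).mono_left nhdsWithin_le_nhds
    have htF : Tendsto (fun t : ℝ => w / α * t) (𝓝[>] 1)
        (𝓝ˢ (Metric.sphere (0 : ℂ) 1) ⊓ 𝓟 (annulus 1 R)) :=
      tendsto_inf.2 ⟨ht.mono_right (nhds_le_nhdsSet (by simpa using hu)),
        tendsto_principal.2 hmem⟩
    have hlim : Tendsto (h ∘ fun t : ℝ => w / α * t) (𝓝[>] 1) (𝓝 w) := by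
      have h1 := (hN _ hu0).tendsto.comp ht
      have e : α * nitscheMap (w / α) = w := by
        have := nitscheMap_mul_ofReal hu one_ne_zero
        rw [h1N, Complex.ofReal_one, mul_one] at this
        rw [this]
        field_simp
      rw [e] at h1
      exact h1.congr' (hmem.mono fun t ht => (hh ht).symm)
    exact MapClusterPt.of_comp htF hlim.mapClusterPt

lemma mem_harmonicHomeos_of_mem_nitscheRotations {R : ℝ} (hR : 1 < R) {h : ℂ → ℂ}
    (hh : h ∈ nitscheRotations R) : h ∈ harmonicHomeos 1 R 1 (nitscheRadius R) := by
  obtain ⟨α, hα, hh⟩ := hh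
  have hα0 : α ≠ 0 := norm_pos_iff.1 (by rw [hα]; exact one_pos)
  refine ⟨fun z hz => ?_, (isHomeoOn_mul_nitscheMap hR hα).congr hh,
    (preservesOrientationOn_mul_nitscheMap hα0).congr hh, clusterSet_nitsche hR hα hh⟩
  exact (InnerProductSpace.harmonicAt_congr_nhds (hh.symm.eventuallyEq_of_mem
    ((isOpen_annulus 1 R).mem_nhds hz))).1
    (harmonicAt_mul_nitscheMap α (ne_zero_of_mem_annulus hz))

lemma circleAverage_eq_zero_of_eq_mul_exp {f : ℂ → ℂ} {ρ : ℝ} (c : ℂ)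
    (hf : ∀ θ : ℝ, f (circleMap 0 ρ θ) = c * Complex.exp (θ * Complex.I)) :
    Real.circleAverage f 0 ρ = 0 := by
  have h0 := coeff_const_mul c (fun θ : ℝ => Complex.exp (θ * Complex.I)) 0
  rw [coeff_exp_of_ne (by norm_num), mul_zero] at h0
  simpa [coeff, mean, Real.circleAverage_def, hf] using h0

lemma circleMap_zero_mem_annulus {R ρ : ℝ} (h1 : 1 < ρ) (h2 : ρ < R) (θ : ℝ) :
    circleMap 0 ρ θ ∈ annulus 1 R := by
  rw [annulus, mem_ofPred_eq, norm_circleMap_zero, abs_of_pos (by linarith)]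
  exact ⟨h1, h2⟩

lemma circleMap_zero_eq (ρ θ : ℝ) : circleMap 0 ρ θ = Complex.exp (θ * Complex.I) * ρ := by
  simp [circleMap, mul_comm]

lemma mem_harmonicHomeosD_of_mem_nitscheRotations {R : ℝ} (hR : 1 < R) {h : ℂ → ℂ}
    (hh : h ∈ nitscheRotations R) : h ∈ harmonicHomeosD 1 R 1 (nitscheRadius R) := by
  refine ⟨mem_harmonicHomeos_of_mem_nitscheRotations hR hh, ?_⟩
  obtain ⟨α, hα, hh⟩ := hh
  refine tendsto_const_nhds.congr' ?_
  filter_upwards [Ioo_mem_nhdsGT hR] with ρ hρ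
  refine (circleAverage_eq_zero_of_eq_mul_exp (α * nitscheRadius ρ) fun θ => ?_).symm
  rw [hh (circleMap_zero_mem_annulus hρ.1 hρ.2 θ)]
  simp only
  rw [circleMap_zero_eq, nitscheMap_mul_ofReal (Complex.norm_exp_ofReal_mul_I θ)
    (by linarith [hρ.1])]
  ring

lemma mem_harmonicHomeosN_of_mem_nitscheRotations {R : ℝ} (hR : 1 < R) {h : ℂ → ℂ}
    (hh : h ∈ nitscheRotations R) : h ∈ harmonicHomeosN 1 R 1 (nitscheRadius R) := by
  have hmem := mem_harmonicHomeos_of_mem_nitscheRotations hR hh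
  obtain ⟨α, hα, hh⟩ := hh
  obtain ⟨ρ, h1, h2⟩ := exists_between hR
  have hρ0 : ρ ≠ 0 := by linarith
  refine ⟨hmem, ρ, h1, h2,
    circleAverage_eq_zero_of_eq_mul_exp (α * ((1 / 2) * (1 - 1 / ρ ^ 2) : ℝ)) fun θ => ?_⟩
  set u := Complex.exp (θ * Complex.I) with hu
  have hu1 : ‖u‖ = 1 := Complex.norm_exp_ofReal_mul_I θ
  have hzA := circleMap_zero_mem_annulus h1 h2 θ
  have hd := ((contDiffAt_of_mem hmem hzA).differentiableAt (by norm_num)).hasFDerivAt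
  have hz : circleMap 0 ρ θ = u * ρ := circleMap_zero_eq ρ θ
  have hdir : circleMap 0 ρ θ / (‖circleMap 0 ρ θ‖ : ℂ) = u := by
    have : (ρ : ℂ) ≠ 0 := by exact_mod_cast hρ0
    rw [norm_circleMap_zero, abs_of_pos (by linarith), hz]
    field_simp
  -- The normal derivative is computed along the ray through `u`, where the map is `α u` times the
  -- radial profile. It is thus a constant multiple of `exp (iθ)`, whose circular mean is zero.
  have hray : HasDerivAt (fun t : ℝ => u * (t : ℂ)) u ρ := by
    simpa using (Complex.ofRealCLM.hasDerivAt (x := ρ)).const_mul u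
  rw [hz] at hd
  have hd1 := hd.comp_hasDerivAt ρ hray
  have hrad : HasDerivAt nitscheRadius ((1 / 2) * (1 - 1 / ρ ^ 2)) ρ := by
    have := ((hasDerivAt_id' ρ).add ((hasDerivAt_id' ρ).inv hρ0)).const_mul (1 / 2)
    refine (this.congr_deriv (by ring)).congr_of_eventuallyEq (.of_forall fun t => ?_)
    simp [nitscheRadius]
  have hd2 : HasDerivAt (h ∘ fun t : ℝ => u * (t : ℂ))
      (α * u * ((1 / 2) * (1 - 1 / ρ ^ 2) : ℝ)) ρ := by
    refine (hrad.ofReal_comp.const_mul (α * u)).congr_of_eventuallyEq ?_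
    filter_upwards [Ioo_mem_nhds h1 h2] with t ht
    have hmemt : u * (t : ℂ) ∈ annulus 1 R := by
      have := circleMap_zero_mem_annulus ht.1 ht.2 θ
      rwa [circleMap_zero_eq] at this
    simp only [Function.comp_apply]
    rw [hh hmemt]
    simp only
    rw [nitscheMap_mul_ofReal hu1 (by linarith [ht.1])]
    ring
  rw [normalDeriv, hdir, hz, hd1.unique hd2]
  ring

end nitsche

end NitscheAnnuli

theorem mainTheorem5 (R Rs : ℝ) (hR : 1 < R) (hRs : Rs = (1 / 2) * (R + 1 / R)) :
    NitscheAnnuli.harmonicHomeosD 1 R 1 Rs = NitscheAnnuli.nitscheRotations R ∧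
    NitscheAnnuli.harmonicHomeosN 1 R 1 Rs = NitscheAnnuli.nitscheRotations R ∧
    (Real.log R ≤ 3 / 2 →
      NitscheAnnuli.harmonicHomeos 1 R 1 Rs = NitscheAnnuli.nitscheRotations R) := by
  have h1 : Rs = Real.cosh (Real.log R) := hRs.trans (NitscheAnnuli.cosh_log_eq hR).symm
  have h2 : Rs = NitscheAnnuli.nitscheRadius R := hRs
  refine ⟨Set.Subset.antisymm (fun h hh => ?_) fun h hh => ?_,
    Set.Subset.antisymm (fun h hh => ?_) fun h hh => ?_,
    fun hlog => Set.Subset.antisymm (fun h hh => ?_) fun h hh => ?_⟩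
  · exact NitscheAnnuli.mem_nitscheRotations_of_mem_harmonicHomeosD hR (h1 ▸ hh)
  · exact h2 ▸ NitscheAnnuli.mem_harmonicHomeosD_of_mem_nitscheRotations hR hh
  · exact NitscheAnnuli.mem_nitscheRotations_of_mem_harmonicHomeosN hR (h1 ▸ hh)
  · exact h2 ▸ NitscheAnnuli.mem_harmonicHomeosN_of_mem_nitscheRotations hR hh
  · exact NitscheAnnuli.mem_nitscheRotations_of_log_le hR hlog (h1 ▸ hh)
  · exact h2 ▸ NitscheAnnuli.mem_harmonicHomeos_of_mem_nitscheRotations hR hh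

end
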